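/- Let $A=(a_{ij})$ be a real $n\times m$ matrix with row index set $X=\{1,\dots,n\}$ and column index set $Y=\{1,\dots,m\}$, let $\epsilon\ge 0$ be real and let $minRow$ be an integer with $1\le minRow\le n$. A pair $(I,J)$ with $I\subseteq X$, $J\subseteq Y$ is a (correct) CVC bicluster with maximum perturbation $\epsilon$ if $\max_{i\in I}a_{ij}-\min_{i\in I}a_{ij}\le\epsilon$ for all $j\in J$. It is maximal if it is correct, $(I\cup\{x\},J)$ is not correct for any $x\in X\setminus I$, and $(I,J\cup\{y\})$ is not correct for any $y\in Y\setminus J$. The algorithm RIn-Close\_CVC2 is the recursive procedure $\mathrm{ComputeBiclustersFrom}((I,J),y,\Gamma)$, first called with $I=X$, $J=\emptyset$, $y=1$, $\Gamma=\emptyset$, which does the following. 1. For $j=y,\dots,m$ with $j\notin J$: if $\max_{i\in I}a_{ij}-\min_{i\in I}a_{ij}\le\epsilon$, put $j$ into $J$. Otherwise compute, by sorting the rows of $I$ by their values in column $j$ and scanning, all inclusion-maximal $G\subseteq I$ with $\max_{i\in G}a_{ij}-\min_{i\in G}a_{ij}\le\epsilon$. For each such $G$ with $|G|\ge minRow$ that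 is canonical and row-canonical, put $(G,j,\Omega)$ into a queue, where $\Omega=\Gamma\cup\{i\in I\setminus G: p_1-a_{ij}\le\epsilon\ \text{or}\ a_{ij}-p_2\le\epsilon\}$ and $p_1$, $p_2$ are the $minRow$-th smallest and the $minRow$-th largest of the values $a_{ij}$, $i\in G$ (counted with multiplicity). 2. Output $(I,J)$. 3. For each $(G,j,\Omega)$ in the queue, in order, call $\mathrm{ComputeBiclustersFrom}((G,J\cup\{j\}),j+1,\Omega)$. Here, with the current $J$ and with $J^{<j}=\{k\in J:k<j\}$ and $I^{<g}=\{i\in I:i<g\}$: $G$ is canonical if there is no column $k<j$, $k\notin J$, with $\max_{i\in G}a_{ik}-\min_{i\in G}a_{ik}\le\epsilon$; and $G$ is row-canonical if there is no $g\in\Gamma$ for which $(G\cup\{g\},J^{<j}\cup\{j\})$ is a correct CVC bicluster, and no $g\in\Gamma$ for which $(I^{<g}\cup\{g\}\cup G,J^{<j})$ is a correct CVC bicluster. No table of the biclusters already found is kept. Running time is the number of elementary steps, where an elementary step is an access to a matrix entry, a subtraction or comparison of two real numbers, a comparison of two indices, or an access to one cell of an array or list. **Proposition.** RIn-Close\_CVC2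 is 1. efficient: there is an absolute constant $C$ such that, whenever $m\ge 1$, its running time is at most $C\,q\,n^3m^2$, where $q$ is the number of maximal CVC biclusters of $A$ with maximum perturbation $\epsilon$ and at least $minRow$ rows; 2. complete: every maximal CVC bicluster with at least $minRow$ rows is output; 3. correct: every pair that is output is a CVC bicluster with maximum perturbation $\epsilon$ (and has at least $minRow$ rows); 4. non-redundant: every pair that is output is a maximal CVC bicluster, and no pair is output more than once. In particular, for $minRow=1$ it outputs all maximal CVC biclusters, each exactly once. -/

import Mathlib

namespace RInClose

/-! ### Biclusters with constant values on columns -/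

/-- `(I, J)` is a correct CVC bicluster with maximum perturbation `ε`: in every column of `J`,
the maximum minus the minimum over the rows of `I` is at most `ε`. -/
def IsCVC {n m : ℕ} (A : Matrix (Fin n) (Fin m) ℝ) (ε : ℝ)
    (I : Finset (Fin n)) (J : Finset (Fin m)) : Prop :=
  ∀ j ∈ J, ∀ h : I.Nonempty, (I.sup' h fun i => A i j) - (I.inf' h fun i => A i j) ≤ ε

/-- A correct CVC bicluster to which no further row and no further column can be added. -/
def IsMaximalCVC {n m : ℕ} (A : Matrix (Fin n) (Fin m) ℝ) (ε : ℝ)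
    (I : Finset (Fin n)) (J : Finset (Fin m)) : Prop :=
  IsCVC A ε I J ∧ (∀ x ∉ I, ¬ IsCVC A ε (insert x I) J) ∧ (∀ y ∉ J, ¬ IsCVC A ε I (insert y J))

/-- The maximal CVC biclusters with at least `minRow` rows. -/
def maximalBiclusters {n m : ℕ} (A : Matrix (Fin n) (Fin m) ℝ) (ε : ℝ) (minRow : ℕ) :
    Set (Finset (Fin n) × Finset (Fin m)) :=
  {B | IsMaximalCVC A ε B.1 B.2 ∧ minRow ≤ B.1.card}

/-! ### Programs with a step count

A program returns a value together with the number of elementary steps it has made.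
One step is one of: reading a matrix entry, subtracting or comparing two reals, comparing two
indices, reading or writing one cell of a Boolean array, inspecting or building one list cell.
Sets of rows are stored as lists, sets of columns as Boolean arrays. -/

structure Timed (α : Type) where
  val : α
  time : ℕ

instance : Monad Timed where
  pure a := ⟨a, 0⟩
  bind p f := ⟨(f p.val).val, p.time + (f p.val).time⟩

/-- One elementary step with result `a`. -/
def step {α : Type} (a : α) : Timed α := ⟨a, 1⟩

/-- Make `c` elementary steps. -/
def charge (c : ℕ) : Timed Unit := ⟨(), c⟩

noncomputable section

def leq (x y : ℝ) : Timed Bool := step (decide (x ≤ y))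

def checkAll {α : Type} (p : α → Timed Bool) : List α → Timed Bool
  | [] => step true
  | x :: xs => do
    charge 1
    let b ← p x
    if b then checkAll p xs else step false

def checkAny {α : Type} (p : α → Timed Bool) : List α → Timed Bool
  | [] => step false
  | x :: xs => do
    charge 1
    let b ← p x
    if b then step true else checkAny p xs

def filterT {α : Type} (p : α → Timed Bool) : List α → Timed (List α)
  | [] => step []
  | x :: xs => do
    let b ← p x
    let r ← filterT p xs
    if b then step (x :: r) else step r

def appendT {α : Type} : List α → List α → Timed (List α)
  | [], ys => step ys
  | x :: xs, ys => do
    let r ← appendT xs ys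
    step (x :: r)

def lengthT {α : Type} : List α → Timed ℕ
  | [] => step 0
  | _ :: xs => do
    let l ← lengthT xs
    step (l + 1)

section Algorithm

variable {n m : ℕ} (A : Matrix (Fin n) (Fin m) ℝ) (ε : ℝ)

def entry (i : Fin n) (k : Fin m) : Timed ℝ := step (A i k)

/-- Maximum of `x` and the entries of column `k` in the listed rows. -/
def colMax (k : Fin m) : ℝ → List (Fin n) → Timed ℝ
  | x, [] => step x
  | x, i :: L => do
    let a ← entry A i k
    let b ← leq x a
    colMax k (if b then a else x) L

/-- Minimum of `x` and the entries of column `k` in the listed rows. -/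
def colMin (k : Fin m) : ℝ → List (Fin n) → Timed ℝ
  | x, [] => step x
  | x, i :: L => do
    let a ← entry A i k
    let b ← leq x a
    colMin k (if b then x else a) L

/-- Test whether `max - min ≤ ε` holds in column `k` over the listed rows. -/
def consistent (k : Fin m) : List (Fin n) → Timed Bool
  | [] => step true
  | i :: L => do
    let x ← entry A i k
    let hi ← colMax A k x L
    let lo ← colMin A k x L
    let d ← step (hi - lo)
    leq d ε

def insertByCol (j : Fin m) (i : Fin n) : List (Fin n) → Timed (List (Fin n))
  | [] => step [i]
  | h :: t => do
    let x ← entry A i j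
    let y ← entry A h j
    let b ← leq x y
    if b then step (i :: h :: t)
    else do
      let r ← insertByCol j i t
      step (h :: r)

/-- Sort the listed rows by their values in column `j`, in ascending order. -/
def sortByCol (j : Fin m) : List (Fin n) → Timed (List (Fin n))
  | [] => step []
  | i :: t => do
    let s ← sortByCol j t
    insertByCol A j i s

/-- The longest prefix of rows whose value in column `j` exceeds `a` by at most `ε`. -/
def windowFrom (j : Fin m) (a : ℝ) : List (Fin n) → Timed (List (Fin n))
  | [] => step []
  | i :: t => do
    let x ← entry A i j
    let d ← step (x - a)
    let b ← leq d ε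
    if b then do
      let r ← windowFrom j a t
      step (i :: r)
    else step []

/-- Scroll through a sorted list of rows and return the maximal windows of width at most `ε`.
`p` is the length of the window that starts at the previous row (`0` at the first row); the window
at the present row is kept if and only if it reaches beyond the end of the previous one. -/
def windows (j : Fin m) : ℕ → List (Fin n) → Timed (List (List (Fin n)))
  | _, [] => step []
  | p, i :: t => do
    let a ← entry A i j
    let w ← windowFrom A ε j a (i :: t)
    let l ← lengthT w
    let b ← step (decide (p ≤ l))
    let rest ← windows j l t
    if b then step (w :: rest) else step rest

/-- The possible new row-sets in column `j`: the maximal subsets of `I` whose values in column `j`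
differ by at most `ε`. -/
def newRowSets (I : List (Fin n)) (j : Fin m) : Timed (List (List (Fin n))) := do
  let s ← sortByCol A j I
  windows A ε j 0 s

/-- `G` is canonical: no column `k < j` outside `J` can be added. -/
def canonical (J : Fin m → Bool) (j : Fin m) (G : List (Fin n)) : Timed Bool :=
  checkAll (fun k => do
    let before ← step (decide (k < j))
    if before then do
      let inJ ← step (J k)
      if inJ then step true
      else do
        let c ← consistent A ε k G
        step (!c)
    else step true) (List.finRange m)

/-- Test whether the listed rows form a correct bicluster with the columns `k < j` of `J`. -/
def correctBefore (J : Fin m → Bool) (j : Fin m) (L : List (Fin n)) : Timed Bool :=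
  checkAll (fun k => do
    let before ← step (decide (k < j))
    if before then do
      let inJ ← step (J k)
      if inJ then consistent A ε k L else step true
    else step true) (List.finRange m)

/-- `G` is row-canonical: there is no `g ∈ Γ` such that `G ∪ {g}` is correct over the columns of `J`
before `j` together with `j`, and no `g ∈ Γ` such that `{i ∈ I | i < g} ∪ {g} ∪ G` is correct over
the columns of `J` before `j`. -/
def rowCanonical (I : List (Fin n)) (J : Fin m → Bool) (Γ : List (Fin n)) (j : Fin m)
    (G : List (Fin n)) : Timed Bool := do
  let t1 ← checkAny (fun g => do
    let c ← correctBefore A ε J j (g :: G)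
    if c then consistent A ε j (g :: G) else step false) Γ
  if t1 then step false
  else do
    let t2 ← checkAny (fun g => do
      let P ← filterT (fun i => step (decide (i < g))) I
      let Q ← appendT P (g :: G)
      correctBefore A ε J j Q) Γ
    step (!t2)

/-- The value in column `j` of the row at position `k` (counted from `0`) of a list. -/
def nthValue (j : Fin m) : List (Fin n) → ℕ → Timed ℝ
  | [], _ => step 0
  | i :: _, 0 => entry A i j
  | _ :: t, k + 1 => do
    charge 1
    nthValue j t k

/-- ComputeRM: with `p1` and `p2` the `minRow`-th smallest and the `minRow`-th largest value of
column `j` in the rows `G`, add to `Γ` the rows `i ∈ I \ G` with `p1 - A i j ≤ ε` or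
`A i j - p2 ≤ ε`. -/
def computeRM (minRow : ℕ) (G : List (Fin n)) (j : Fin m) (Γ I : List (Fin n)) :
    Timed (List (Fin n)) := do
  let s ← sortByCol A j G
  let l ← lengthT s
  let p1 ← nthValue A j s (minRow - 1)
  let p2 ← nthValue A j s (l - minRow)
  let D ← filterT (fun i => do
    let inG ← checkAny (fun g => step (decide (i = g))) G
    if inG then step false
    else do
      let x ← entry A i j
      let d1 ← step (p1 - x)
      let b1 ← leq d1 ε
      if b1 then step true
      else do
        let d2 ← step (x - p2)
        leq d2 ε) I
  appendT Γ D

/-- An entry `(G, j, Ω)` of the queue. -/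
structure QueueItem (n m : ℕ) where
  rows : List (Fin n)
  col : Fin m
  check : List (Fin n)

/-- The loop over the possible new row-sets in column `j`; it returns the new queue entries. -/
def candidateLoop (minRow : ℕ) (I : List (Fin n)) (J : Fin m → Bool) (Γ : List (Fin n))
    (j : Fin m) : List (List (Fin n)) → Timed (List (QueueItem n m))
  | [] => step []
  | G :: Gs => do
    let l ← lengthT G
    let large ← step (decide (minRow ≤ l))
    let can ← if large then canonical A ε J j G else step false
    let rowCan ← if can then rowCanonical A ε I J Γ j G else step false
    if rowCan then do
      let Ω ← computeRM A ε minRow G j Γ I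
      let rest ← candidateLoop minRow I J Γ j Gs
      step (⟨G, j, Ω⟩ :: rest)
    else candidateLoop minRow I J Γ j Gs

/-- The loop over the columns; it returns the closed column-set and the queue. -/
def columnLoop (minRow : ℕ) (I Γ : List (Fin n)) :
    List (Fin m) → (Fin m → Bool) → Timed ((Fin m → Bool) × List (QueueItem n m))
  | [], J => step (J, [])
  | j :: js, J => do
    let inJ ← step (J j)
    if inJ then columnLoop minRow I Γ js J
    else do
      let c ← consistent A ε j I
      if c then do
        let J' ← step (Function.update J j true)
        columnLoop minRow I Γ js J'
      else do
        let Gs ← newRowSets A ε I j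
        let new ← candidateLoop A ε minRow I J Γ j Gs
        let r ← columnLoop minRow I Γ js J
        let queue ← appendT new r.2
        step (r.1, queue)

/-- Process the queue entries in order with the procedure `rec`, which extends the output. -/
def drainQueue {α : Type} (rec : QueueItem n m → List α → Timed (List α)) :
    List (QueueItem n m) → List α → Timed (List α)
  | [], out => step out
  | q :: qs, out => do
    let out' ← rec q out
    drainQueue rec qs out'

/-- ComputeBiclustersFrom `((I, J), y, Γ)`. The argument `out` is the output written so far, the
latest bicluster first. The first argument bounds the depth of the recursion; as `y` grows in every
recursive call and a call with `y = m` makes none, the depth never exceeds `m + 1`. Writing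
`(I, J)` to the output and copying the array `J` for a descendant are charged by their lengths. -/
def computeBiclustersFrom (minRow : ℕ) :
    ℕ → List (Fin n) → (Fin m → Bool) → ℕ → List (Fin n) →
      List (List (Fin n) × (Fin m → Bool)) → Timed (List (List (Fin n) × (Fin m → Bool)))
  | 0, _, _, _, _, out => step out
  | depth + 1, I, J, y, Γ, out => do
    let r ← columnLoop A ε minRow I Γ ((List.finRange m).drop y) J
    charge (I.length + m)
    let out' ← step ((I, r.1) :: out)
    drainQueue (fun q acc => do
      charge m
      let H ← step (Function.update r.1 q.col true)
      computeBiclustersFrom minRow depth q.rows H (q.col + 1) q.check acc) r.2 out'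

/-- RIn-Close_CVC2: the call with all rows, no column, the first column as the current attribute
and `Γ` empty. Setting up the initial row list and column array takes `n + m` steps. -/
def rinCloseCVC2 (minRow : ℕ) : Timed (List (List (Fin n) × (Fin m → Bool))) := do
  charge (n + m)
  computeBiclustersFrom A ε minRow (m + 1) (List.finRange n) (fun _ => false) 0 [] []

/-- The list of biclusters that RIn-Close_CVC2 writes, with repetitions if there are any. -/
def output (minRow : ℕ) : List (Finset (Fin n) × Finset (Fin m)) :=
  (rinCloseCVC2 A ε minRow).val.map fun B =>
    (B.1.toFinset, Finset.univ.filter fun j => B.2 j = true)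

/-- The number of elementary steps that RIn-Close_CVC2 makes. -/
def runningTime (minRow : ℕ) : ℕ := (rinCloseCVC2 A ε minRow).time

end Algorithm

end

end RInClose

/-! A maximal bicluster is determined by its row set: the columns must be all those that are close
on the rows, and the rows must be `RowMaximal` (`isMaximalCVC_iff`). The problem is thus to
enumerate the row-maximal sets with at least `minRow` rows, each once, and the proof arranges them
in a tree with root the full row set.

For a row-maximal `S` other than the root, let `j` be the first column such that no row can be added
to `S` over its close columns up to `j`. The parent of `S` is the lexicographically first extension
of `S` over its close columns before `j`. It is row-maximal, strictly larger than `S` and unique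
(`RowMaximal.exists_isParent`, `isParent_rightUnique`), so every row-maximal set has a chain of
parents up to the root. As sets only grow along such a chain, discarding sets with fewer than
`minRow` rows loses no large descendant.

The queue built in a call on `I` holds exactly the large sets whose parent is `I`
(`isParentAt_of_mem_queue`, `exists_mem_queue`). The canonicity test says that closing `G` before
`j` gives nothing that is not close on `I`; the two row tests say that `G` is maximal up to `j` and
that `I` is the first extension. The row tests consult only `Γ`. This suffices because a row outside
both `I` and `Γ` is blocked, in some earlier column close on `I`, from joining any large subset of
`I` (field `excluded` of `IsCallState`). The recursion therefore traverses the tree, and sibling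
subtrees are disjoint (`eq_of_common_descendant`), so no set is met twice.

Each call writes one bicluster. It treats at most `m` columns with at most `n` candidates each, and
a candidate costs a multiple of `n ^ 2 * m`; this gives a multiple of `n ^ 3 * m ^ 2` per output. -/

namespace RInClose

/-! ### Values and step counts of the basic operations. -/

namespace Timed

variable {α β : Type}

@[simp] theorem val_bind (p : Timed α) (f : α → Timed β) : (p >>= f).val = (f p.val).val := rfl

@[simp] theorem time_bind (p : Timed α) (f : α → Timed β) :
    (p >>= f).time = p.time + (f p.val).time := rfl

@[simp] theorem val_step (a : α) : (step a).val = a := rfl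

@[simp] theorem time_step (a : α) : (step a).time = 1 := rfl

@[simp] theorem time_charge (c : ℕ) : (charge c).time = c := rfl

@[simp] theorem val_ite (p : Prop) [Decidable p] (x y : Timed α) :
    (if p then x else y).val = if p then x.val else y.val := apply_ite _ _ _ _

@[simp] theorem time_ite (p : Prop) [Decidable p] (x y : Timed α) :
    (if p then x else y).time = if p then x.time else y.time := apply_ite _ _ _ _

@[simp] theorem val_leq (x y : ℝ) : (leq x y).val = decide (x ≤ y) := rfl

@[simp] theorem time_leq (x y : ℝ) : (leq x y).time = 1 := rfl

end Timed

/-! ### List programs. -/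

section ListPrograms

variable {α : Type}

@[simp] theorem val_checkAll (p : α → Timed Bool) (l : List α) :
    (checkAll p l).val = l.all fun x => (p x).val := by
  induction l with
  | nil => rfl
  | cons x xs ih => cases h : (p x).val <;> simp [checkAll, h, ih]

@[simp] theorem val_checkAny (p : α → Timed Bool) (l : List α) :
    (checkAny p l).val = l.any fun x => (p x).val := by
  induction l with
  | nil => rfl
  | cons x xs ih => cases h : (p x).val <;> simp [checkAny, h, ih]

@[simp] theorem val_filterT (p : α → Timed Bool) (l : List α) :
    (filterT p l).val = l.filter fun x => (p x).val := by
  induction l with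
  | nil => rfl
  | cons x xs ih => cases h : (p x).val <;> simp [filterT, h, ih]

@[simp] theorem val_appendT (l l' : List α) : (appendT l l').val = l ++ l' := by
  induction l with
  | nil => rfl
  | cons x xs ih => simp [appendT, ih]

@[simp] theorem val_lengthT (l : List α) : (lengthT l).val = l.length := by
  induction l with
  | nil => rfl
  | cons x xs ih => simp [lengthT, ih]

theorem time_checkAll_le {p : α → Timed Bool} {l : List α} {c : ℕ}
    (h : ∀ x ∈ l, (p x).time ≤ c) : (checkAll p l).time ≤ l.length * (c + 1) + 1 := by
  induction l with
  | nil => simp [checkAll]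
  | cons x xs ih =>
    have hx := h x (by simp)
    have ih := ih fun y hy => h y (by simp [hy])
    simp only [checkAll, Timed.time_bind, Timed.time_charge, Timed.time_ite, Timed.time_step,
      List.length_cons, add_mul, one_mul] at ih ⊢
    split_ifs <;> omega

theorem time_checkAny_le {p : α → Timed Bool} {l : List α} {c : ℕ}
    (h : ∀ x ∈ l, (p x).time ≤ c) : (checkAny p l).time ≤ l.length * (c + 1) + 1 := by
  induction l with
  | nil => simp [checkAny]
  | cons x xs ih =>
    have hx := h x (by simp)
    have ih := ih fun y hy => h y (by simp [hy])
    simp only [checkAny, Timed.time_bind, Timed.time_charge, Timed.time_ite, Timed.time_step,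
      List.length_cons, add_mul, one_mul] at ih ⊢
    split_ifs <;> omega

theorem time_filterT_le {p : α → Timed Bool} {l : List α} {c : ℕ}
    (h : ∀ x ∈ l, (p x).time ≤ c) : (filterT p l).time ≤ l.length * (c + 1) + 1 := by
  induction l with
  | nil => simp [filterT]
  | cons x xs ih =>
    have hx := h x (by simp)
    have ih := ih fun y hy => h y (by simp [hy])
    simp only [filterT, Timed.time_bind, Timed.time_ite, Timed.time_step,
      List.length_cons, add_mul, one_mul] at ih ⊢
    split_ifs <;> omega

@[simp] theorem time_appendT (l l' : List α) : (appendT l l').time = l.length + 1 := by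
  induction l with
  | nil => rfl
  | cons x xs ih => simp [appendT, ih]

@[simp] theorem time_lengthT (l : List α) : (lengthT l).time = l.length + 1 := by
  induction l with
  | nil => rfl
  | cons x xs ih => simp [lengthT, ih]

end ListPrograms

/-! ### Closeness in a column, and the consistency and canonicity tests. -/

variable {n m : ℕ} {A : Matrix (Fin n) (Fin m) ℝ} {ε : ℝ}

@[simp] theorem val_entry (i : Fin n) (k : Fin m) : (entry A i k).val = A i k := rfl

@[simp] theorem time_entry (i : Fin n) (k : Fin m) : (entry A i k).time = 1 := rfl

/-- The values of column `k` in the rows of `S` differ by at most `ε`. -/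
def Close (A : Matrix (Fin n) (Fin m) ℝ) (ε : ℝ) (S : Finset (Fin n)) (k : Fin m) : Prop :=
  ∀ x ∈ S, ∀ y ∈ S, A x k - A y k ≤ ε

theorem Close.mono {S T : Finset (Fin n)} {k : Fin m} (h : Close A ε T k) (hST : S ⊆ T) :
    Close A ε S k :=
  fun x hx y hy => h x (hST hx) y (hST hy)

theorem isCVC_iff {I : Finset (Fin n)} {J : Finset (Fin m)} :
    IsCVC A ε I J ↔ ∀ j ∈ J, Close A ε I j := by
  refine forall₂_congr fun j _ => ⟨fun h x hx y hy => ?_, fun h hne => ?_⟩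
  · have h := h ⟨x, hx⟩
    have h1 := Finset.le_sup' (fun i => A i j) hx
    have h2 := Finset.inf'_le (fun i => A i j) hy
    exact (sub_le_sub h1 h2).trans h
  · obtain ⟨x, hx, hx'⟩ := Finset.exists_mem_eq_sup' hne fun i => A i j
    obtain ⟨y, hy, hy'⟩ := Finset.exists_mem_eq_inf' hne fun i => A i j
    rw [hx', hy']
    exact h x hx y hy

/-- Describing the running maximum by its upper bounds makes the induction immediate;
`val_consistent` needs nothing more about it. -/
theorem val_colMax (k : Fin m) (x : ℝ) (L : List (Fin n)) (c : ℝ) :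
    (colMax A k x L).val ≤ c ↔ x ≤ c ∧ ∀ i ∈ L, A i k ≤ c := by
  induction L generalizing x with
  | nil => simp [colMax]
  | cons i L ih =>
    simp only [colMax, Timed.val_bind, val_entry, Timed.val_leq, ih, decide_eq_true_eq,
      List.forall_mem_cons]
    split_ifs with h
    · exact ⟨fun ⟨h1, h2⟩ => ⟨h.trans h1, h1, h2⟩, fun ⟨_, h2⟩ => h2⟩
    · exact ⟨fun ⟨h1, h2⟩ => ⟨h1, (not_le.1 h).le.trans h1, h2⟩, fun ⟨h1, _, h2⟩ => ⟨h1, h2⟩⟩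

theorem val_colMin (k : Fin m) (x : ℝ) (L : List (Fin n)) (c : ℝ) :
    c ≤ (colMin A k x L).val ↔ c ≤ x ∧ ∀ i ∈ L, c ≤ A i k := by
  induction L generalizing x with
  | nil => simp [colMin]
  | cons i L ih =>
    simp only [colMin, Timed.val_bind, val_entry, Timed.val_leq, ih, decide_eq_true_eq,
      List.forall_mem_cons]
    split_ifs with h
    · exact ⟨fun ⟨h1, h2⟩ => ⟨h1, h1.trans h, h2⟩, fun ⟨h1, _, h2⟩ => ⟨h1, h2⟩⟩
    · exact ⟨fun ⟨h1, h2⟩ => ⟨h1.trans (not_le.1 h).le, h1, h2⟩, fun ⟨_, h2⟩ => h2⟩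

theorem val_consistent (k : Fin m) (L : List (Fin n)) :
    (consistent A ε k L).val = true ↔ Close A ε L.toFinset k := by
  cases L with
  | nil => simp [consistent, Close]
  | cons i L =>
    have key : ∀ c : ℝ, (colMax A k (A i k) L).val ≤ c ↔ ∀ x ∈ (i :: L).toFinset, A x k ≤ c := by
      simp [val_colMax]
    have key' : ∀ c : ℝ, c ≤ (colMin A k (A i k) L).val ↔ ∀ x ∈ (i :: L).toFinset, c ≤ A x k := by
      simp [val_colMin]
    simp only [consistent, Timed.val_bind, val_entry, Timed.val_leq, Timed.val_step,
      decide_eq_true_eq, tsub_le_iff_right, key]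
    refine forall₂_congr fun x _ => ?_
    rw [← sub_le_iff_le_add', key']
    exact forall₂_congr fun y _ => sub_le_comm

theorem val_canonical (J : Fin m → Bool) (j : Fin m) (G : List (Fin n)) :
    (canonical A ε J j G).val = true ↔ ∀ k < j, J k = false → ¬ Close A ε G.toFinset k := by
  simp only [canonical, val_checkAll, List.all_eq_true, List.mem_finRange, true_imp_iff]
  refine forall_congr' fun k => ?_
  rw [← val_consistent]
  by_cases h : k < j <;> cases J k <;> simp [h]

theorem val_correctBefore (J : Fin m → Bool) (j : Fin m) (L : List (Fin n)) :
    (correctBefore A ε J j L).val = true ↔ ∀ k < j, J k = true → Close A ε L.toFinset k := by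
  simp only [correctBefore, val_checkAll, List.all_eq_true, List.mem_finRange, true_imp_iff]
  refine forall_congr' fun k => ?_
  rw [← val_consistent]
  by_cases h : k < j <;> cases J k <;> simp [h]

theorem val_rowCanonical (I : List (Fin n)) (J : Fin m → Bool) (Γ : List (Fin n)) (j : Fin m)
    (G : List (Fin n)) :
    (rowCanonical A ε I J Γ j G).val = true ↔ ∀ g ∈ Γ,
      ¬ ((∀ k < j, J k = true → Close A ε (insert g G.toFinset) k) ∧
        Close A ε (insert g G.toFinset) j) ∧
      ¬ ∀ k < j, J k = true →
        Close A ε (I.toFinset.filter (· < g) ∪ insert g G.toFinset) k := by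
  have h1 : ∀ g, (do
      let c ← correctBefore A ε J j (g :: G)
      if c then consistent A ε j (g :: G) else step false : Timed Bool).val = true ↔
      ((∀ k < j, J k = true → Close A ε (insert g G.toFinset) k) ∧
        Close A ε (insert g G.toFinset) j) := fun g => by
    rw [← List.toFinset_cons, ← val_correctBefore, ← val_consistent]
    simp
  have h2 : ∀ g, (do
      let P ← filterT (fun i => step (decide (i < g))) I
      let Q ← appendT P (g :: G)
      correctBefore A ε J j Q : Timed Bool).val = true ↔
      ∀ k < j, J k = true →
        Close A ε (I.toFinset.filter (· < g) ∪ insert g G.toFinset) k := fun g => by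
    rw [Timed.val_bind, Timed.val_bind, val_correctBefore]
    have : ((appendT (filterT (fun i => step (decide (i < g))) I).val (g :: G)).val).toFinset =
        I.toFinset.filter (· < g) ∪ insert g G.toFinset := by
      ext; simp
    rw [this]
  simp only [rowCanonical, Timed.val_bind, Timed.val_ite, val_checkAny, Timed.val_step] at h1 h2 ⊢
  simp only [forall_and]
  split_ifs with h
  · obtain ⟨g, hg, hg'⟩ := List.any_eq_true.1 h
    have := (h1 g).1 hg'
    constructor
    · simp
    · exact fun H => absurd this (H.1 g hg)
  · rw [List.any_eq_true] at h
    push Not at h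
    rw [Bool.not_eq_true', ← Bool.not_eq_true, List.any_eq_true]
    constructor
    · intro H
      refine ⟨fun g hg hh => h g hg ((h1 g).2 hh), fun g hg hh => H ⟨g, hg, (h2 g).2 hh⟩⟩
    · rintro ⟨_, H⟩ ⟨g, hg, hh⟩
      exact H g hg ((h2 g).1 hh)

/-! ### Sorting a column and its maximal windows. -/

theorem val_insertByCol (j : Fin m) (i : Fin n) (L : List (Fin n)) :
    (insertByCol A j i L).val = L.orderedInsert (fun x y => A x j ≤ A y j) i := by
  induction L with
  | nil => rfl
  | cons h t ih =>
    simp [insertByCol, ih, List.orderedInsert_cons]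

theorem val_sortByCol (j : Fin m) (L : List (Fin n)) :
    (sortByCol A j L).val = L.insertionSort (fun x y => A x j ≤ A y j) := by
  induction L with
  | nil => rfl
  | cons h t ih => simp [sortByCol, val_insertByCol, ih]

theorem sortByCol_perm (j : Fin m) (L : List (Fin n)) : (sortByCol A j L).val.Perm L := by
  rw [val_sortByCol]
  exact List.perm_insertionSort _ _

theorem sortByCol_pairwise (j : Fin m) (L : List (Fin n)) :
    (sortByCol A j L).val.Pairwise (fun x y => A x j ≤ A y j) := by
  rw [val_sortByCol]
  have : Std.Total (fun x y : Fin n => A x j ≤ A y j) := ⟨fun x y => le_total _ _⟩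
  have : IsTrans (Fin n) (fun x y : Fin n => A x j ≤ A y j) := ⟨fun _ _ _ => le_trans⟩
  exact List.pairwise_insertionSort _ _

theorem val_windowFrom (j : Fin m) (a : ℝ) (L : List (Fin n)) :
    (windowFrom A ε j a L).val = L.takeWhile fun i => decide (A i j - a ≤ ε) := by
  induction L with
  | nil => rfl
  | cons i t ih =>
    by_cases h : A i j - a ≤ ε <;> simp [windowFrom, h, ih, -tsub_le_iff_right]

theorem val_windows_cons (j : Fin m) (p : ℕ) (i : Fin n) (t : List (Fin n)) (hε : 0 ≤ ε) :
    (windows A ε j p (i :: t)).val =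
      (if p ≤ (t.takeWhile fun x => decide (A x j - A i j ≤ ε)).length + 1 then
        [i :: t.takeWhile fun x => decide (A x j - A i j ≤ ε)] else []) ++
      (windows A ε j ((t.takeWhile fun x => decide (A x j - A i j ≤ ε)).length + 1) t).val := by
  have hw : (windowFrom A ε j (A i j) (i :: t)).val =
      i :: t.takeWhile fun x => decide (A x j - A i j ≤ ε) := by
    simp [val_windowFrom, hε]
  simp only [windows, Timed.val_bind, val_entry, val_lengthT, Timed.val_step, Timed.val_ite, hw,
    List.length_cons, decide_eq_true_eq]
  split_ifs <;> rfl

theorem mem_takeWhile_of_pairwise {j : Fin m} {L : List (Fin n)} {a : ℝ}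
    (hL : L.Pairwise (fun x y => A x j ≤ A y j)) {x : Fin n} :
    x ∈ (L.takeWhile fun i => decide (A i j - a ≤ ε)) ↔ x ∈ L ∧ A x j - a ≤ ε := by
  induction L with
  | nil => simp
  | cons i t ih =>
    rw [List.pairwise_cons] at hL
    by_cases h : A i j - a ≤ ε
    · rw [List.takeWhile_cons_of_pos (by simpa using h), List.mem_cons, ih hL.2, List.mem_cons]
      constructor
      · rintro (rfl | h')
        · exact ⟨Or.inl rfl, h⟩
        · exact ⟨Or.inr h'.1, h'.2⟩
      · rintro ⟨rfl | h1, h2⟩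
        · exact Or.inl rfl
        · exact Or.inr ⟨h1, h2⟩
    · rw [List.takeWhile_cons_of_neg (by simpa using h)]
      simp only [List.not_mem_nil, List.mem_cons, false_iff, not_and]
      rintro (rfl | h1) h2
      · exact h h2
      · exact h (by linarith [hL.1 x h1])

theorem sublist_of_mem_windows (hε : 0 ≤ ε) {j : Fin m} {p : ℕ} {L w : List (Fin n)}
    (hw : w ∈ (windows A ε j p L).val) : w.Sublist L := by
  induction L generalizing p with
  | nil => simp [windows] at hw
  | cons i t ih =>
    rw [val_windows_cons _ _ _ _ hε, List.mem_append] at hw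
    rcases hw with hw | hw
    · split_ifs at hw
      · rw [List.mem_singleton] at hw
        rw [hw]
        exact (List.takeWhile_sublist _).cons_cons i
      · simp at hw
    · exact (ih hw).cons i

/-- Here `a` is the value of the row just before `L`, and the `+ 1` counts that row in its own
window. A later window is kept only if it reaches past the previous one, so it contains a value that
the earlier row cannot be combined with. -/
theorem exists_mem_window_gt (hε : 0 ≤ ε) {j : Fin m} {L w : List (Fin n)} {a : ℝ}
    (hL : L.Pairwise (fun x y => A x j ≤ A y j)) (ha : ∀ x ∈ L, a ≤ A x j)
    (hw : w ∈ (windows A ε j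
      ((L.takeWhile fun x => decide (A x j - a ≤ ε)).length + 1) L).val) :
    ∃ x ∈ w, ε < A x j - a := by
  induction L generalizing a with
  | nil => simp [windows] at hw
  | cons i t ih =>
    rw [val_windows_cons _ _ _ _ hε, List.mem_append] at hw
    have hai := ha i (by simp)
    have hL' := List.pairwise_cons.1 hL
    rcases hw with hw | hw
    · split_ifs at hw with h
      · rw [List.mem_singleton] at hw
        -- If all of `w` lay within `ε` of `a`, it would be a prefix of the previous window with its
        -- first row removed, but the length test makes it longer than that.
        by_contra! hcon
        have hwpre : w <+: i :: t := by
          rw [hw, List.cons_prefix_cons]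
          exact ⟨rfl, List.takeWhile_prefix _⟩
        have hpre : w <+: (i :: t).takeWhile fun x => decide (A x j - a ≤ ε) := by
          obtain ⟨r, hr⟩ := hwpre
          rw [← hr, List.takeWhile_append_of_pos fun x hx => decide_eq_true (hcon x hx)]
          exact List.prefix_append _ _
        have := hpre.length_le
        rw [hw] at this
        simp only [List.length_cons] at this
        omega
      · simp at hw
    · obtain ⟨x, hx, hx'⟩ := ih hL'.2 hL'.1 hw
      exact ⟨x, hx, by linarith⟩

/-- Every window is a maximal set of listed rows with close values. -/
theorem windows_sound (hε : 0 ≤ ε) {j : Fin m} {p : ℕ} {L w : List (Fin n)}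
    (hL : L.Pairwise (fun x y => A x j ≤ A y j)) (hw : w ∈ (windows A ε j p L).val) :
    Close A ε w.toFinset j ∧ ∀ g ∈ L, g ∉ w → ¬ Close A ε (insert g w.toFinset) j := by
  induction L generalizing p with
  | nil => simp [windows] at hw
  | cons i t ih =>
    rw [val_windows_cons _ _ _ _ hε, List.mem_append] at hw
    have hL' := List.pairwise_cons.1 hL
    rcases hw with hw | hw
    · split_ifs at hw with h
      · rw [List.mem_singleton] at hw
        have hmem : ∀ x, x ∈ w ↔ x ∈ i :: t ∧ A x j - A i j ≤ ε := by
          intro x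
          rw [← mem_takeWhile_of_pairwise hL, List.takeWhile_cons_of_pos (by simpa using hε), hw]
        have hmin : ∀ x ∈ i :: t, A i j ≤ A x j := by
          intro x hx
          rcases List.mem_cons.1 hx with rfl | hx
          · exact le_rfl
          · exact hL'.1 x hx
        refine ⟨fun x hx y hy => ?_, fun g hg hgw hcl => ?_⟩
        · rw [List.mem_toFinset, hmem] at hx hy
          linarith [hmin y hy.1]
        · exact hgw ((hmem g).2 ⟨hg, hcl g (by simp) i (by simp [hw])⟩)
      · simp at hw
    · refine ⟨(ih hL'.2 hw).1, fun g hg hgw => ?_⟩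
      rcases List.mem_cons.1 hg with rfl | hg
      · obtain ⟨x, hx, hx'⟩ := exists_mem_window_gt hε hL'.2 hL'.1 hw
        intro hcl
        exact absurd (hcl x (by simp [hx]) g (by simp)) (not_le.2 hx')
      · exact (ih hL'.2 hw).2 g hg hgw

/-- Every maximal set of listed rows with close values is a window. -/
theorem windows_complete (hε : 0 ≤ ε) {j : Fin m} {p : ℕ} {L : List (Fin n)} {S : Finset (Fin n)}
    (hL : L.Pairwise (fun x y => A x j ≤ A y j)) (hSL : ∀ x ∈ S, x ∈ L) (hne : S.Nonempty)
    (hS : Close A ε S j) (hmax : ∀ g ∈ L, g ∉ S → ¬ Close A ε (insert g S) j)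
    -- Either there is no previous row, or the window of the previous row, with value `a`, does not
    -- reach the end of `S`; this invariant makes the length test accept the window equal to `S`.
    (hp : p = 0 ∨ ∃ a, p = (L.takeWhile fun x => decide (A x j - a ≤ ε)).length + 1 ∧
      ∃ x ∈ S, ε < A x j - a) :
    ∃ w ∈ (windows A ε j p L).val, w.toFinset = S := by
  induction L generalizing p with
  | nil =>
    obtain ⟨x, hx⟩ := hne
    exact absurd (hSL x hx) (by simp)
  | cons i t ih =>
    rw [val_windows_cons _ _ _ _ hε]
    have hL' := List.pairwise_cons.1 hL
    have hmin : ∀ x ∈ i :: t, A i j ≤ A x j := by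
      intro x hx
      rcases List.mem_cons.1 hx with rfl | hx
      · exact le_rfl
      · exact hL'.1 x hx
    by_cases hi : i ∈ S
    · set w := i :: t.takeWhile fun x => decide (A x j - A i j ≤ ε) with hw
      have hmem : ∀ x, x ∈ w ↔ x ∈ i :: t ∧ A x j - A i j ≤ ε := by
        intro x
        rw [← mem_takeWhile_of_pairwise hL, List.takeWhile_cons_of_pos (by simpa using hε), hw]
      have hwS : w.toFinset = S := by
        ext x
        rw [List.mem_toFinset, hmem]
        refine ⟨fun ⟨hx, hx'⟩ => ?_, fun hx => ⟨hSL x hx, hS x hx i hi⟩⟩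
        by_contra hxS
        refine hmax x hx hxS fun y hy z hz => ?_
        have hy' : y ∈ i :: t ∧ A y j - A i j ≤ ε := by
          rcases Finset.mem_insert.1 hy with rfl | hy
          · exact ⟨hx, hx'⟩
          · exact ⟨hSL y hy, hS y hy i hi⟩
        have hz' : z ∈ i :: t := by
          rcases Finset.mem_insert.1 hz with rfl | hz
          · exact hx
          · exact hSL z hz
        linarith [hmin z hz']
      have hple : p ≤ (t.takeWhile fun x => decide (A x j - A i j ≤ ε)).length + 1 := by
        rcases hp with rfl | ⟨a, rfl, x, hx, hxa⟩
        · exact Nat.zero_le _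
        · by_contra! hlt
          have hpre : w <+: (i :: t).takeWhile fun x => decide (A x j - a ≤ ε) := by
            refine List.prefix_of_prefix_length_le (l₃ := i :: t) ?_ (List.takeWhile_prefix _) ?_
            · rw [hw, List.cons_prefix_cons]
              exact ⟨rfl, List.takeWhile_prefix _⟩
            · rw [hw, List.length_cons]
              omega
          have hxw : x ∈ w := by rwa [← List.mem_toFinset, hwS]
          have := (mem_takeWhile_of_pairwise hL).1 (hpre.subset hxw)
          exact absurd this.2 (not_le.2 hxa)
      exact ⟨w, by rw [if_pos hple]; simp, hwS⟩
    · have hSt : ∀ x ∈ S, x ∈ t := fun x hx =>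
        (List.mem_cons.1 (hSL x hx)).resolve_left fun h => hi (h ▸ hx)
      -- Otherwise the smallest row `i` could be added to `S`, against maximality.
      obtain ⟨x, hx, hxa⟩ : ∃ x ∈ S, ε < A x j - A i j := by
        by_contra! hcon
        refine hmax i (by simp) hi fun y hy z hz => ?_
        have hy' : A y j - A i j ≤ ε := by
          rcases Finset.mem_insert.1 hy with rfl | hy
          · simpa using hε
          · exact hcon y hy
        have hz' : z ∈ i :: t := by
          rcases Finset.mem_insert.1 hz with rfl | hz
          · simp
          · exact hSL z hz
        linarith [hmin z hz']
      obtain ⟨w, hw, hwS⟩ := ih hL'.2 hSt (fun g hg => hmax g (by simp [hg]))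
        (Or.inr ⟨A i j, rfl, x, hx, hxa⟩)
      exact ⟨w, List.mem_append_right _ hw, hwS⟩

theorem windows_pairwise (hε : 0 ≤ ε) {j : Fin m} {p : ℕ} {L : List (Fin n)} (hL : L.Nodup) :
    (windows A ε j p L).val.Pairwise fun w w' => w.toFinset ≠ w'.toFinset := by
  induction L generalizing p with
  | nil => simp [windows]
  | cons i t ih =>
    rw [val_windows_cons _ _ _ _ hε]
    rw [List.nodup_cons] at hL
    split_ifs
    · rw [List.singleton_append, List.pairwise_cons]
      -- The window that starts at `i` contains `i`, while later windows lie in the tail, which does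
      -- not.
      refine ⟨fun w hw heq => hL.1 ?_, ih hL.2⟩
      have : i ∈ w.toFinset := by rw [← heq]; simp
      exact (sublist_of_mem_windows hε hw).subset (List.mem_toFinset.1 this)
    · exact ih hL.2

theorem length_windows_le (hε : 0 ≤ ε) {j : Fin m} {p : ℕ} {L : List (Fin n)} :
    (windows A ε j p L).val.length ≤ L.length := by
  induction L generalizing p with
  | nil => simp [windows]
  | cons i t ih =>
    rw [val_windows_cons _ _ _ _ hε, List.length_append, List.length_cons, add_comm]
    refine Nat.add_le_add ih ?_
    split_ifs <;> simp

theorem subperm_of_mem_newRowSets (hε : 0 ≤ ε) {I G : List (Fin n)} {j : Fin m}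
    (hG : G ∈ (newRowSets A ε I j).val) : G.Subperm I :=
  (sublist_of_mem_windows hε hG).subperm.trans (sortByCol_perm j I).subperm

theorem newRowSets_sound (hε : 0 ≤ ε) {I G : List (Fin n)} {j : Fin m}
    (hG : G ∈ (newRowSets A ε I j).val) :
    Close A ε G.toFinset j ∧ ∀ g ∈ I, g ∉ G → ¬ Close A ε (insert g G.toFinset) j := by
  have := windows_sound hε (sortByCol_pairwise j I) hG
  simpa only [(sortByCol_perm j I).mem_iff] using this

theorem newRowSets_complete (hε : 0 ≤ ε) {I : List (Fin n)} {j : Fin m} {S : Finset (Fin n)}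
    (hSI : S ⊆ I.toFinset) (hne : S.Nonempty) (hS : Close A ε S j)
    (hmax : ∀ g ∈ I, g ∉ S → ¬ Close A ε (insert g S) j) :
    ∃ G ∈ (newRowSets A ε I j).val, G.toFinset = S := by
  refine windows_complete hε (sortByCol_pairwise j I) (fun x hx => ?_) hne hS ?_ (Or.inl rfl)
  · rw [(sortByCol_perm j I).mem_iff]
    exact List.mem_toFinset.1 (hSI hx)
  · simpa only [(sortByCol_perm j I).mem_iff] using hmax

theorem newRowSets_pairwise (hε : 0 ≤ ε) {I : List (Fin n)} (hI : I.Nodup) (j : Fin m) :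
    (newRowSets A ε I j).val.Pairwise fun w w' => w.toFinset ≠ w'.toFinset :=
  windows_pairwise hε ((sortByCol_perm j I).nodup_iff.2 hI)

theorem length_newRowSets_le (hε : 0 ≤ ε) (I : List (Fin n)) (j : Fin m) :
    (newRowSets A ε I j).val.length ≤ I.length :=
  (length_windows_le hε).trans (sortByCol_perm j I).length_eq.le

/-! ### Order statistics and the rows kept for later checks. -/

theorem val_nthValue {j : Fin m} {L : List (Fin n)} {k : ℕ} (hk : k < L.length) :
    (nthValue A j L k).val = A L[k] j := by
  induction L generalizing k with
  | nil => simp at hk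
  | cons i t ih =>
    cases k with
    | zero => rfl
    | succ k => simpa [nthValue] using ih (by simpa using hk)

/-- A set with more than `k` rows does not fit into the first `k` positions of the sorted list. -/
theorem nthValue_le_of_card_lt {j : Fin m} {L : List (Fin n)} {k : ℕ} {S : Finset (Fin n)}
    (hL : L.Pairwise (fun x y => A x j ≤ A y j)) (hS : S ⊆ L.toFinset) (hk : k < S.card) :
    ∃ x ∈ S, (nthValue A j L k).val ≤ A x j := by
  have hkL : k < L.length := hk.trans_le ((Finset.card_le_card hS).trans (List.toFinset_card_le L))
  rw [val_nthValue hkL]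
  by_contra! hcon
  have hsub : S ⊆ (L.take k).toFinset := by
    intro x hx
    have hxL := List.mem_toFinset.1 (hS hx)
    rw [← List.take_append_drop k L, List.mem_append] at hxL
    refine List.mem_toFinset.2 (hxL.resolve_right fun h => ?_)
    have hd := List.drop_eq_getElem_cons hkL
    have hp := hL.sublist (List.drop_sublist k L)
    rw [hd] at h hp
    rcases List.mem_cons.1 h with rfl | h
    · exact lt_irrefl _ (hcon _ hx)
    · exact absurd ((List.pairwise_cons.1 hp).1 x h) (not_le.2 (hcon x hx))
  have := (Finset.card_le_card hsub).trans (List.toFinset_card_le _)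
  rw [List.length_take] at this
  omega

/-- The second threshold can stay unspecified: a row is dropped only if it fails both tests, and
failing the first already excludes it from every large set. -/
theorem val_computeRM (minRow : ℕ) (G : List (Fin n)) (j : Fin m) (Γ I : List (Fin n)) :
    ∃ p2 : ℝ, (computeRM A ε minRow G j Γ I).val = Γ ++ I.filter fun i => decide (i ∉ G ∧
      ((nthValue A j (sortByCol A j G).val (minRow - 1)).val - A i j ≤ ε ∨
        A i j - p2 ≤ ε)) := by
  refine ⟨(nthValue A j (sortByCol A j G).val ((sortByCol A j G).val.length - minRow)).val, ?_⟩
  simp only [computeRM, Timed.val_bind, val_lengthT, val_appendT, val_filterT]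
  congr 1
  refine List.filter_congr fun i _ => ?_
  rw [val_checkAny]
  have : (G.any fun g => (step (decide (i = g))).val) = decide (i ∈ G) := by
    rw [Bool.eq_iff_iff]
    simp
  rw [this]
  by_cases hi : i ∈ G
  · simp [hi]
  · simp only [hi, decide_false, Bool.false_eq_true, if_false, Timed.val_bind, val_entry,
      Timed.val_step, Timed.val_ite, Timed.val_leq, decide_eq_true_eq, not_false_eq_true,
      true_and]
    split_ifs with h <;> simp [h, -tsub_le_iff_right]

theorem mem_or_of_mem_computeRM {minRow : ℕ} {G : List (Fin n)} {j : Fin m} {Γ I : List (Fin n)}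
    {g : Fin n} (hg : g ∈ (computeRM A ε minRow G j Γ I).val) : g ∈ Γ ∨ g ∈ I ∧ g ∉ G := by
  obtain ⟨p2, h⟩ := val_computeRM (A := A) (ε := ε) minRow G j Γ I
  rw [h, List.mem_append, List.mem_filter, decide_eq_true_eq] at hg
  exact hg.imp_right fun h => ⟨h.1, h.2.1⟩

theorem subset_computeRM (minRow : ℕ) (G : List (Fin n)) (j : Fin m) (Γ I : List (Fin n)) :
    Γ ⊆ (computeRM A ε minRow G j Γ I).val := by
  obtain ⟨p2, h⟩ := val_computeRM (A := A) (ε := ε) minRow G j Γ I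
  rw [h]
  exact List.subset_append_left _ _

theorem nodup_computeRM {minRow : ℕ} {G : List (Fin n)} {j : Fin m} {Γ I : List (Fin n)}
    (hΓ : Γ.Nodup) (hI : I.Nodup) (hd : ∀ g ∈ Γ, g ∉ I) :
    (computeRM A ε minRow G j Γ I).val.Nodup := by
  obtain ⟨p2, h⟩ := val_computeRM (A := A) (ε := ε) minRow G j Γ I
  rw [h]
  refine hΓ.append (hI.filter _) fun g hg hg' => hd g hg (List.mem_filter.1 hg').1

/-- A discarded row that `computeRM` does not keep cannot be added to a large set of rows of `G`. -/
theorem not_close_of_notMem_computeRM {minRow : ℕ} {G : List (Fin n)} {j : Fin m}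
    {Γ I : List (Fin n)} {g : Fin n} (hmin : 1 ≤ minRow) (hgI : g ∈ I) (hgG : g ∉ G)
    (hg : g ∉ (computeRM A ε minRow G j Γ I).val) {S : Finset (Fin n)} (hS : S ⊆ G.toFinset)
    (hcard : minRow ≤ S.card) : ¬ Close A ε (insert g S) j := by
  obtain ⟨p2, h⟩ := val_computeRM (A := A) (ε := ε) minRow G j Γ I
  rw [h, List.mem_append, List.mem_filter, decide_eq_true_eq] at hg
  push Not at hg
  have hp := (hg.2 hgI hgG).1
  -- Some row of `S` has a value at least `p1`, whereas the value of `g` is below `p1 - ε`.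
  obtain ⟨x, hx, hx'⟩ := nthValue_le_of_card_lt (A := A) (k := minRow - 1) (S := S)
    (sortByCol_pairwise j G) (by rwa [List.toFinset_eq_of_perm _ _ (sortByCol_perm j G)])
    (by omega)
  intro hcl
  have := hcl x (by simp [hx]) g (by simp)
  linarith

/-! ### The parent of a maximal row set -/

/-- No row can be added to `S` over the columns that are close on `S`. -/
def RowMaximal (A : Matrix (Fin n) (Fin m) ℝ) (ε : ℝ) (S : Finset (Fin n)) : Prop :=
  ∀ g ∉ S, ∃ k, Close A ε S k ∧ ¬ Close A ε (insert g S) k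

/-- `I` is the parent of `G` at column `j`: the row set `G` is maximal over its close columns up to
`j` but not over those before `j`, and `I` is the lexicographically first extension of `G` over the
latter. -/
structure IsParentAt (A : Matrix (Fin n) (Fin m) ℝ) (ε : ℝ) (j : Fin m) (G I : Finset (Fin n)) :
    Prop where
  ssubset : G ⊂ I
  close : Close A ε G j
  not_close : ¬ Close A ε I j
  close_before : ∀ k < j, Close A ε G k → Close A ε I k
  maximal : ∀ g ∉ G, ∃ k ≤ j, Close A ε G k ∧ ¬ Close A ε (insert g G) k
  first : ∀ g ∉ I, ∃ k < j, Close A ε G k ∧ ¬ Close A ε (I.filter (· < g) ∪ insert g G) k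

def IsParent (A : Matrix (Fin n) (Fin m) ℝ) (ε : ℝ) (G I : Finset (Fin n)) : Prop :=
  ∃ j, IsParentAt A ε j G I

/-- If `j < j'`, then a row of `I'` outside `G` can be added to `G` over all its close columns up to
`j`, which contradicts maximality at `j`. -/
theorem IsParentAt.col_unique {j j' : Fin m} {G I I' : Finset (Fin n)}
    (h : IsParentAt A ε j G I) (h' : IsParentAt A ε j' G I') : j = j' := by
  have key : ∀ {j j' : Fin m} {I I' : Finset (Fin n)}, IsParentAt A ε j G I →
      IsParentAt A ε j' G I' → ¬ j < j' := by
    intro j j' I I' h h' hlt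
    obtain ⟨x, hx, hxG⟩ := Finset.exists_of_ssubset h'.ssubset
    obtain ⟨k, hk, hc, hnc⟩ := h.maximal x hxG
    exact hnc ((h'.close_before k (hk.trans_lt hlt) hc).mono
      (Finset.insert_subset hx h'.ssubset.subset))
  exact le_antisymm (not_lt.1 (key h' h)) (not_lt.1 (key h h'))

/-- Take the least row `g` in exactly one of the two sets. Below `g` the sets agree, so the set
containing `g` witnesses that the other is not the first extension. -/
theorem IsParentAt.rows_unique {j : Fin m} {G I I' : Finset (Fin n)}
    (h : IsParentAt A ε j G I) (h' : IsParentAt A ε j G I') : I = I' := by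
  by_contra hne
  have key : ∀ {I I' : Finset (Fin n)} {g : Fin n}, IsParentAt A ε j G I →
      IsParentAt A ε j G I' → g ∈ I → g ∉ I' → (∀ x < g, x ∈ I' → x ∈ I) → False := by
    intro I I' g h h' hg hg' hlt
    obtain ⟨k, hk, hc, hnc⟩ := h'.first g hg'
    refine hnc ((h.close_before k hk hc).mono ?_)
    refine Finset.union_subset (fun x hx => ?_) (Finset.insert_subset hg h.ssubset.subset)
    rw [Finset.mem_filter] at hx
    exact hlt x hx.2 hx.1
  have hex : ∃ g, ¬ (g ∈ I ↔ g ∈ I') := by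
    by_contra! hcon
    exact hne (Finset.ext hcon)
  obtain ⟨g, hg, hmin⟩ := WellFounded.has_min (wellFounded_lt (α := Fin n))
    {g | ¬ (g ∈ I ↔ g ∈ I')} hex
  have hmin' : ∀ x < g, (x ∈ I ↔ x ∈ I') := fun x hx => by
    by_contra hcon
    exact hmin x hcon hx
  by_cases hgI : g ∈ I
  · have hgI' : g ∉ I' := fun hh => hg ⟨fun _ => hh, fun _ => hgI⟩
    exact key h h' hgI hgI' fun x hx => (hmin' x hx).2
  · have hgI' : g ∈ I' := by
      by_contra hh
      exact hg ⟨fun h => absurd h hgI, fun h => absurd h hh⟩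
    exact key h' h hgI' hgI fun x hx => (hmin' x hx).1

theorem isParent_rightUnique : Relator.RightUnique (IsParent A ε) := by
  rintro G I I' ⟨j, h⟩ ⟨j', h'⟩
  obtain rfl := h.col_unique h'
  exact h.rows_unique h'

theorem subset_of_reflTransGen {S T : Finset (Fin n)}
    (h : Relation.ReflTransGen (IsParent A ε) S T) : S ⊆ T := by
  induction h with
  | refl => exact subset_rfl
  | tail _ h ih =>
    obtain ⟨j, h⟩ := h
    exact ih.trans h.ssubset.subset

/-- Two different children of the same parent have no common descendant. -/
theorem eq_of_common_descendant {D G G' I : Finset (Fin n)} (hG : IsParent A ε G I)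
    (hG' : IsParent A ε G' I) (h : Relation.ReflTransGen (IsParent A ε) D G)
    (h' : Relation.ReflTransGen (IsParent A ε) D G') : G = G' := by
  have key : ∀ {G G'}, IsParent A ε G I → IsParent A ε G' I →
      Relation.ReflTransGen (IsParent A ε) G G' → G = G' := by
    intro G G' hG hG' h
    rcases h.cases_head with h | ⟨I', h1, h2⟩
    · exact h
    · obtain rfl := isParent_rightUnique hG h1
      obtain ⟨j, hj⟩ := hG'
      exact absurd (subset_of_reflTransGen h2) hj.ssubset.not_subset
  -- With unique parents the ancestors of `D` form a chain, so `G` and `G'` are comparable. A proper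
  -- step from one to the other would pass through `I`, which strictly contains both.
  rcases Relation.ReflTransGen.total_of_right_unique isParent_rightUnique h h' with h | h
  · exact key hG hG' h
  · exact (key hG' hG h).symm

/-- The lexicographically first extension of `S` with a property. -/
theorem exists_first_extension (P : Finset (Fin n) → Prop) (S : Finset (Fin n)) (hS : P S) :
    ∃ I, S ⊆ I ∧ P I ∧ ∀ g ∉ I, ¬ P (I.filter (· < g) ∪ insert g S) := by
  -- Greedy scan of the rows in increasing order: row `t` is taken whenever the property survives.
  -- At that moment every row added so far is below `t`, so the lexicographic candidate is just
  -- `insert t I`.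
  have key : ∀ t ≤ n, ∃ I, S ⊆ I ∧ P I ∧ (∀ x ∈ I, x ∉ S → (x : ℕ) < t) ∧
      ∀ g ∉ I, (g : ℕ) < t → ¬ P (I.filter (· < g) ∪ insert g S) := by
    intro t
    induction t with
    | zero => exact fun _ => ⟨S, subset_rfl, hS, fun x hx hx' => absurd hx hx', by simp⟩
    | succ t ih =>
      intro ht
      obtain ⟨I, hSI, hI, hlt, hfirst⟩ := ih (by omega)
      have hunion : ∀ g : Fin n, (g : ℕ) = t → I.filter (· < g) ∪ insert g S = insert g I := by
        intro g hg
        ext x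
        simp only [Finset.mem_union, Finset.mem_filter, Finset.mem_insert]
        constructor
        · rintro (h | h | h)
          · exact Or.inr h.1
          · exact Or.inl h
          · exact Or.inr (hSI h)
        · rintro (h | h)
          · exact Or.inr (Or.inl h)
          · by_cases hx : x ∈ S
            · exact Or.inr (Or.inr hx)
            · exact Or.inl ⟨h, Fin.lt_def.2 (hg ▸ hlt x h hx)⟩
      by_cases hP : P (insert ⟨t, ht⟩ I)
      · refine ⟨insert ⟨t, ht⟩ I, hSI.trans (Finset.subset_insert _ _), hP, fun x hx hxS => ?_,
          fun g hg hgt => ?_⟩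
        · rcases Finset.mem_insert.1 hx with rfl | hx
          · simp
          · have := hlt x hx hxS
            omega
        · rw [Finset.mem_insert, not_or] at hg
          have hne : (g : ℕ) ≠ t := fun h => hg.1 (Fin.ext h)
          have hlt' : (g : ℕ) < t := by omega
          rw [Finset.filter_insert, if_neg (by rw [Fin.lt_def]; simp; omega)]
          exact hfirst g hg.2 hlt'
      · refine ⟨I, hSI, hI, fun x hx hxS => (hlt x hx hxS).trans (Nat.lt_succ_self t),
          fun g hg hgt => ?_⟩
        rcases Nat.lt_succ_iff_lt_or_eq.1 hgt with h | h
        · exact hfirst g hg h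
        · rw [hunion g h]
          have : g = ⟨t, ht⟩ := Fin.ext h
          rwa [this]
  obtain ⟨I, h1, h2, _, h4⟩ := key n le_rfl
  exact ⟨I, h1, h2, fun g hg => h4 g hg g.2⟩

theorem RowMaximal.exists_isParent {S : Finset (Fin n)} (hS : RowMaximal A ε S)
    (hne : S ≠ Finset.univ) : ∃ I, IsParent A ε S I ∧ RowMaximal A ε I := by
  have hex : ∃ t : ℕ, ∀ g ∉ S, ∃ k : Fin m, (k : ℕ) < t ∧ Close A ε S k ∧
      ¬ Close A ε (insert g S) k := by
    refine ⟨m, fun g hg => ?_⟩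
    obtain ⟨k, hk⟩ := hS g hg
    exact ⟨k, k.2, hk⟩
  classical
  -- `t` is the least number of initial columns over whose close members `S` is already maximal; the
  -- column sought is `t - 1`.
  have ht := Nat.find_spec hex
  have hmin := fun s (hs : s < Nat.find hex) => Nat.find_min hex hs
  set t := Nat.find hex with htdef
  clear_value t
  obtain ⟨x, hx⟩ : ∃ x, x ∉ S := by
    by_contra! h
    exact hne (Finset.eq_univ_iff_forall.2 h)
  have htpos : 0 < t := by
    obtain ⟨k, hk, _⟩ := ht x hx
    omega
  have hnot := hmin (t - 1) (by omega)
  push Not at hnot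
  -- By minimality of `t`, this row `h` can be added over the close columns before `t - 1`. So
  -- column `t - 1` is close on `S` and is the one that blocks `h`, and the first extension over the
  -- columns before it is proper.
  obtain ⟨h, hhS, hh⟩ := hnot
  obtain ⟨j, hjt, hjc, hjnc⟩ := ht h hhS
  have hj : (j : ℕ) = t - 1 := by
    by_contra hcon
    exact hjnc (hh j (by omega) hjc)
  obtain ⟨I, hSI, hI, hfirst⟩ := exists_first_extension
    (fun T => ∀ k < j, Close A ε S k → Close A ε T k) S fun k _ hk => hk
  have hmax : ∀ g ∉ S, ∃ k ≤ j, Close A ε S k ∧ ¬ Close A ε (insert g S) k := by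
    intro g hg
    obtain ⟨k, hk, hk'⟩ := ht g hg
    exact ⟨k, Fin.le_def.2 (by omega), hk'⟩
  have hfirst' : ∀ g ∉ I, ∃ k < j, Close A ε S k ∧
      ¬ Close A ε (I.filter (· < g) ∪ insert g S) k := by
    intro g hg
    have := hfirst g hg
    push Not at this
    exact this
  have hne' : S ≠ I := by
    rintro rfl
    obtain ⟨k, hk, hc, hnc⟩ := hfirst' h hhS
    refine hnc ((hh k (by rw [← hj]; exact hk) hc).mono ?_)
    exact Finset.union_subset ((Finset.filter_subset _ _).trans (Finset.subset_insert _ _))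
      subset_rfl
  have hss : S ⊂ I := hSI.ssubset_of_ne hne'
  refine ⟨I, ⟨j, hss, hjc, fun hc => ?_, hI, hmax, hfirst'⟩, fun g hg => ?_⟩
  · obtain ⟨y, hy, hyS⟩ := Finset.exists_of_ssubset hss
    obtain ⟨k, hk, hkc, hknc⟩ := hmax y hyS
    have hle : Close A ε I k := by
      rcases hk.lt_or_eq with hk | rfl
      · exact hI k hk hkc
      · exact hc
    exact hknc (hle.mono (Finset.insert_subset hy hSI))
  · obtain ⟨k, hk, hc, hnc⟩ := hfirst' g hg
    refine ⟨k, hI k hk hc, fun hcon => hnc (hcon.mono ?_)⟩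
    exact Finset.union_subset ((Finset.filter_subset _ _).trans (Finset.subset_insert _ _))
      (Finset.insert_subset_insert g hSI)

theorem RowMaximal.reflTransGen_univ {S : Finset (Fin n)} (hS : RowMaximal A ε S) :
    Relation.ReflTransGen (IsParent A ε) S Finset.univ := by
  by_cases hne : S = Finset.univ
  · rw [hne]
  · obtain ⟨I, hSI, hI⟩ := hS.exists_isParent hne
    have : Sᶜ.card > Iᶜ.card := by
      obtain ⟨j, hj⟩ := hSI
      exact Finset.card_lt_card (Finset.compl_ssubset_compl.2 hj.ssubset)
    exact Relation.ReflTransGen.head hSI hI.reflTransGen_univ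
termination_by Sᶜ.card

/-! ### The queue -/

/-- The tests that a candidate `G` in column `j` has to pass. -/
def Accepted (A : Matrix (Fin n) (Fin m) ℝ) (ε : ℝ) (minRow : ℕ) (I : List (Fin n))
    (J : Fin m → Bool) (Γ : List (Fin n)) (j : Fin m) (G : List (Fin n)) : Prop :=
  minRow ≤ G.length ∧ (canonical A ε J j G).val = true ∧ (rowCanonical A ε I J Γ j G).val = true

open Classical in
theorem val_candidateLoop (minRow : ℕ) (I : List (Fin n)) (J : Fin m → Bool) (Γ : List (Fin n))
    (j : Fin m) (Gs : List (List (Fin n))) :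
    (candidateLoop A ε minRow I J Γ j Gs).val =
      (Gs.filter fun G => decide (Accepted A ε minRow I J Γ j G)).map
        fun G => ⟨G, j, (computeRM A ε minRow G j Γ I).val⟩ := by
  induction Gs with
  | nil => rfl
  | cons G Gs ih =>
    by_cases h1 : minRow ≤ G.length
    · by_cases h2 : (canonical A ε J j G).val = true
      · by_cases h3 : (rowCanonical A ε I J Γ j G).val = true
        · rw [List.filter_cons_of_pos (by simpa using ⟨h1, h2, h3⟩)]
          simp [candidateLoop, h1, h2, h3, ih]
        · rw [List.filter_cons_of_neg (by simpa using fun h : Accepted .. => h3 h.2.2)]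
          simp [candidateLoop, h1, h2, h3, ih]
      · rw [List.filter_cons_of_neg (by simpa using fun h : Accepted .. => h2 h.2.1)]
        simp [candidateLoop, h1, h2, ih]
    · rw [List.filter_cons_of_neg (by simpa using fun h : Accepted .. => h1 h.1)]
      simp [candidateLoop, h1, ih]

/-- The tests read `J` only before column `j`, where the current array already agrees with the final
one. Queue membership can thus be stated with the final array. -/
theorem accepted_congr {minRow : ℕ} {I : List (Fin n)} {J J' : Fin m → Bool} {Γ : List (Fin n)}
    {j : Fin m} {G : List (Fin n)} (hJ : ∀ k < j, J k = J' k) :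
    Accepted A ε minRow I J Γ j G ↔ Accepted A ε minRow I J' Γ j G := by
  have h : ∀ (b : Bool) (P : Fin m → Prop),
      (∀ k < j, J k = b → P k) ↔ (∀ k < j, J' k = b → P k) := fun b P =>
    forall₂_congr fun k hk => by rw [hJ k hk]
  simp only [Accepted, val_canonical, val_rowCanonical, h]

/-- What the loop over the columns from `y` on returns. -/
theorem columnLoop_spec {minRow : ℕ} {I Γ : List (Fin n)} {y : ℕ} (hy : y ≤ m)
    {J : Fin m → Bool} (hJ : ∀ k, J k = true → Close A ε I.toFinset k)
    (hJy : ∀ k : Fin m, (k : ℕ) < y → Close A ε I.toFinset k → J k = true) :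
    (∀ k, (columnLoop A ε minRow I Γ ((List.finRange m).drop y) J).val.1 k = true ↔
      Close A ε I.toFinset k) ∧
    (∀ q, q ∈ (columnLoop A ε minRow I Γ ((List.finRange m).drop y) J).val.2 ↔
      y ≤ q.col ∧ ¬ Close A ε I.toFinset q.col ∧ q.rows ∈ (newRowSets A ε I q.col).val ∧
      Accepted A ε minRow I (columnLoop A ε minRow I Γ ((List.finRange m).drop y) J).val.1 Γ
        q.col q.rows ∧ q.check = (computeRM A ε minRow q.rows q.col Γ I).val) ∧
    (0 ≤ ε → I.Nodup →
      (columnLoop A ε minRow I Γ ((List.finRange m).drop y) J).val.2.Pairwise fun q q' =>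
      q.col = q'.col → q.rows.toFinset ≠ q'.rows.toFinset) := by
  induction hd : m - y generalizing y J with
  | zero =>
    have hym : m ≤ y := by omega
    rw [List.drop_eq_nil_of_le (by simpa using hym)]
    simp only [columnLoop, Timed.val_step]
    refine ⟨fun k => ⟨hJ k, hJy k (by omega)⟩, fun q => ?_, fun _ _ => List.Pairwise.nil⟩
    have := q.col.2
    constructor
    · simp
    · intro h
      omega
  | succ d ih =>
    have hym : y < m := by omega
    have hdrop : (List.finRange m).drop y = ⟨y, hym⟩ :: (List.finRange m).drop (y + 1) := by
      rw [List.drop_eq_getElem_cons (by simpa using hym)]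
      simp
    set j : Fin m := ⟨y, hym⟩ with hj
    have hlt : ∀ k : Fin m, (k : ℕ) < y + 1 → k ≠ j → (k : ℕ) < y := by
      intro k hk hkj
      have : (k : ℕ) ≠ y := fun h => hkj (Fin.ext h)
      omega
    rw [hdrop]
    by_cases hc : Close A ε I.toFinset j
    · have hcol : ∀ q : QueueItem n m, ¬ Close A ε I.toFinset q.col →
          (y + 1 ≤ (q.col : ℕ) ↔ y ≤ (q.col : ℕ)) := by
        intro q hq
        have : (q.col : ℕ) ≠ y := fun h => hq (by rwa [show q.col = j from Fin.ext h])
        omega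
      by_cases hJj : J j = true
      · have hval : (columnLoop A ε minRow I Γ (j :: (List.finRange m).drop (y + 1)) J).val =
            (columnLoop A ε minRow I Γ ((List.finRange m).drop (y + 1)) J).val := by
          simp [columnLoop, hJj]
        rw [hval]
        have := ih hym hJ (fun k hk hkc => by
          by_cases hkj : k = j
          · rw [hkj, hJj]
          · exact hJy k (hlt k hk hkj) hkc) (by omega)
        refine ⟨this.1, fun q => (this.2.1 q).trans ?_, this.2.2⟩
        exact ⟨fun h => ⟨(hcol q h.2.1).1 h.1, h.2⟩, fun h => ⟨(hcol q h.2.1).2 h.1, h.2⟩⟩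
      · have hval : (columnLoop A ε minRow I Γ (j :: (List.finRange m).drop (y + 1)) J).val =
            (columnLoop A ε minRow I Γ ((List.finRange m).drop (y + 1))
              (Function.update J j true)).val := by
          simp [columnLoop, hJj, (val_consistent j I).2 hc]
        rw [hval]
        have := ih hym (J := Function.update J j true) (fun k hk => by
          by_cases hkj : k = j
          · rwa [hkj]
          · rw [Function.update_of_ne hkj] at hk
            exact hJ k hk) (fun k hk hkc => by
          by_cases hkj : k = j
          · rw [hkj, Function.update_self]
          · rw [Function.update_of_ne hkj]
            exact hJy k (hlt k hk hkj) hkc) (by omega)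
        refine ⟨this.1, fun q => (this.2.1 q).trans ?_, this.2.2⟩
        exact ⟨fun h => ⟨(hcol q h.2.1).1 h.1, h.2⟩, fun h => ⟨(hcol q h.2.1).2 h.1, h.2⟩⟩
    · have hJj : ¬ J j = true := fun h => hc (hJ j h)
      have hval : (columnLoop A ε minRow I Γ (j :: (List.finRange m).drop (y + 1)) J).val =
          ((columnLoop A ε minRow I Γ ((List.finRange m).drop (y + 1)) J).val.1,
          (candidateLoop A ε minRow I J Γ j (newRowSets A ε I j).val).val ++
            (columnLoop A ε minRow I Γ ((List.finRange m).drop (y + 1)) J).val.2) := by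
        have : ¬ (consistent A ε j I).val = true := fun h => hc ((val_consistent j I).1 h)
        simp [columnLoop, hJj, this]
      rw [hval]
      obtain ⟨h1, h2, h3⟩ := ih hym hJ (fun k hk hkc => by
          by_cases hkj : k = j
          · exact absurd (hkj ▸ hkc) hc
          · exact hJy k (hlt k hk hkj) hkc) (by omega)
      generalize columnLoop A ε minRow I Γ ((List.finRange m).drop (y + 1)) J = r at h1 h2 h3 ⊢
      have hJr : ∀ k < j, J k = r.val.1 k := by
        intro k hk
        rw [Bool.eq_iff_iff, h1 k]
        exact ⟨hJ k, hJy k hk⟩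
      refine ⟨h1, fun q => ?_, fun hε hI => ?_⟩
      · simp only
        rw [List.mem_append, h2, val_candidateLoop, List.mem_map]
        simp only [List.mem_filter, decide_eq_true_eq]
        constructor
        · rintro (⟨G, ⟨hG, hacc⟩, rfl⟩ | h)
          · exact ⟨le_rfl, hc, hG, (accepted_congr hJr).1 hacc, rfl⟩
          · exact ⟨by omega, h.2⟩
        · rintro ⟨hq1, hq2, hq3, hq4, hq5⟩
          by_cases hqj : q.col = j
          · refine Or.inl ⟨q.rows, ⟨hqj ▸ hq3, (accepted_congr hJr).2 (hqj ▸ hq4)⟩, ?_⟩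
            rw [← hqj, ← hq5]
          · have : (q.col : ℕ) ≠ y := fun h => hqj (Fin.ext h)
            exact Or.inr ⟨by omega, hq2, hq3, hq4, hq5⟩
      · simp only
        rw [List.pairwise_append]
        refine ⟨?_, h3 hε hI, fun q hq q' hq' heq => ?_⟩
        · rw [val_candidateLoop, List.pairwise_map]
          refine List.Pairwise.imp ?_ ((newRowSets_pairwise hε hI j).filter _)
          exact fun h _ => h
        · rw [val_candidateLoop, List.mem_map] at hq
          obtain ⟨G, _, rfl⟩ := hq
          have := ((h2 q').1 hq').1
          rw [← heq] at this
          simp [hj] at this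

/-! ### The arguments of the recursive calls -/

/-- The invariant of the arguments `((I, J), y, Γ)` of `computeBiclustersFrom`. -/
structure IsCallState (A : Matrix (Fin n) (Fin m) ℝ) (ε : ℝ) (minRow : ℕ) (I : List (Fin n))
    (J : Fin m → Bool) (y : ℕ) (Γ : List (Fin n)) : Prop where
  le : y ≤ m
  nodup : I.Nodup
  length : minRow ≤ I.length
  close : ∀ k, J k = true → Close A ε I.toFinset k
  closed : ∀ k : Fin m, (k : ℕ) < y → Close A ε I.toFinset k → J k = true
  maximal : ∀ g ∉ I, ∃ k : Fin m, (k : ℕ) < y ∧ Close A ε I.toFinset k ∧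
    ¬ Close A ε (insert g I.toFinset) k
  -- The column `y - 1` that created `I` was needed to make it maximal; hence no child of `I` arises
  -- at a column before `y`.
  least : ∀ t, t + 1 = y → ∃ g ∉ I, ∀ k : Fin m, (k : ℕ) < t → Close A ε I.toFinset k →
    Close A ε (insert g I.toFinset) k
  check_nodup : Γ.Nodup
  check_disjoint : ∀ g ∈ Γ, g ∉ I
  -- Quantifying over all large subsets of `I`, and not only over `I`, lets this pass to
  -- descendants.
  excluded : ∀ g ∉ I, g ∉ Γ → ∃ k : Fin m, (k : ℕ) < y ∧ Close A ε I.toFinset k ∧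
    ∀ S ⊆ I.toFinset, minRow ≤ S.card → ¬ Close A ε (insert g S) k

theorem isCallState_univ {minRow : ℕ} (h : minRow ≤ n) :
    IsCallState A ε minRow (List.finRange n) (fun _ => false) 0 [] where
  le := Nat.zero_le m
  nodup := List.nodup_finRange n
  length := by simpa using h
  close := by simp
  closed := by simp
  maximal := by simp
  least := by simp
  check_nodup := List.nodup_nil
  check_disjoint := by simp
  excluded := by simp

namespace IsCallState

variable {minRow y : ℕ} {I Γ : List (Fin n)} {J : Fin m → Bool}

theorem rowMaximal (h : IsCallState A ε minRow I J y Γ) : RowMaximal A ε I.toFinset := by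
  intro g hg
  obtain ⟨k, _, hk⟩ := h.maximal g (fun h => hg (List.mem_toFinset.2 h))
  exact ⟨k, hk⟩

theorem closed_columns (h : IsCallState A ε minRow I J y Γ) (k : Fin m) :
    (columnLoop A ε minRow I Γ ((List.finRange m).drop y) J).val.1 k = true ↔
      Close A ε I.toFinset k :=
  (columnLoop_spec h.le h.close h.closed).1 k

theorem subset_of_mem_queue (hε : 0 ≤ ε) (h : IsCallState A ε minRow I J y Γ) {q : QueueItem n m}
    (hq : q ∈ (columnLoop A ε minRow I Γ ((List.finRange m).drop y) J).val.2) :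
    q.rows ⊆ I ∧ q.rows.Nodup := by
  have hq := ((columnLoop_spec h.le h.close h.closed).2.1 q).1 hq
  have hs := subperm_of_mem_newRowSets hε hq.2.2.1
  refine ⟨hs.subset, ?_⟩
  obtain ⟨l, hl, hl'⟩ := hs
  exact hl.nodup_iff.1 (h.nodup.sublist hl')

theorem isParentAt_of_mem_queue (hε : 0 ≤ ε) (h : IsCallState A ε minRow I J y Γ)
    {q : QueueItem n m}
    (hq : q ∈ (columnLoop A ε minRow I Γ ((List.finRange m).drop y) J).val.2) :
    IsParentAt A ε q.col q.rows.toFinset I.toFinset ∧ minRow ≤ q.rows.length := by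
  have hsub := h.subset_of_mem_queue hε hq
  have hsubF : q.rows.toFinset ⊆ I.toFinset := fun x hx =>
    List.mem_toFinset.2 (hsub.1 (List.mem_toFinset.1 hx))
  have hspec := columnLoop_spec (minRow := minRow) (Γ := Γ) h.le h.close h.closed
  obtain ⟨hyj, hnc, hmem, ⟨hlen, hcan, hrow⟩, _⟩ := (hspec.2.1 q).1 hq
  have hcl := hspec.1
  generalize columnLoop A ε minRow I Γ ((List.finRange m).drop y) J = r at *
  rw [val_canonical] at hcan
  rw [val_rowCanonical] at hrow
  have hs := newRowSets_sound hε hmem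
  have hbefore : ∀ k < q.col, Close A ε q.rows.toFinset k → Close A ε I.toFinset k := by
    intro k hk hkc
    by_contra hcon
    refine hcan k hk ?_ hkc
    rw [← Bool.not_eq_true, hcl]
    exact hcon
  -- Rows outside `I` and `Γ` need no test: they are blocked in a column before `q.col`.
  have hexcl : ∀ g ∉ I, g ∉ Γ → ∃ k < q.col, Close A ε q.rows.toFinset k ∧
      ¬ Close A ε (insert g q.rows.toFinset) k := by
    intro g hg hgΓ
    obtain ⟨k, hk, hkc, hkS⟩ := h.excluded g hg hgΓ
    exact ⟨k, Fin.lt_def.2 (by omega), hkc.mono hsubF,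
      hkS _ hsubF (by rwa [List.toFinset_card_of_nodup hsub.2])⟩
  refine ⟨⟨⟨hsubF, fun hcon => hnc (hs.1.mono hcon)⟩, hs.1, hnc, hbefore, fun g hg => ?_,
    fun g hg => ?_⟩, hlen⟩
  · rw [List.mem_toFinset] at hg
    by_cases hgI : g ∈ I
    · exact ⟨q.col, le_rfl, hs.1, hs.2 g hgI hg⟩
    · by_cases hgΓ : g ∈ Γ
      · have := (hrow g hgΓ).1
        by_contra! hcon
        refine this ⟨fun k hk hkr => ?_, hcon _ le_rfl hs.1⟩
        exact hcon k hk.le (((hcl k).1 hkr).mono hsubF)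
      · obtain ⟨k, hk, hk'⟩ := hexcl g hgI hgΓ
        exact ⟨k, hk.le, hk'⟩
  · rw [List.mem_toFinset] at hg
    by_cases hgΓ : g ∈ Γ
    · have := (hrow g hgΓ).2
      push Not at this
      obtain ⟨k, hk, hkr, hk'⟩ := this
      exact ⟨k, hk, ((hcl k).1 hkr).mono hsubF, hk'⟩
    · obtain ⟨k, hk, hk', hk''⟩ := hexcl g hg hgΓ
      exact ⟨k, hk, hk', fun hc => hk'' (hc.mono Finset.subset_union_right)⟩

theorem child (hε : 0 ≤ ε) (hmin : 1 ≤ minRow) (h : IsCallState A ε minRow I J y Γ)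
    {q : QueueItem n m}
    (hq : q ∈ (columnLoop A ε minRow I Γ ((List.finRange m).drop y) J).val.2) :
    IsCallState A ε minRow q.rows
      (Function.update (columnLoop A ε minRow I Γ ((List.finRange m).drop y) J).val.1 q.col true)
      (q.col + 1) q.check := by
  have hsub := h.subset_of_mem_queue hε hq
  have hsubF : q.rows.toFinset ⊆ I.toFinset := fun x hx =>
    List.mem_toFinset.2 (hsub.1 (List.mem_toFinset.1 hx))
  obtain ⟨hpar, hlen⟩ := h.isParentAt_of_mem_queue hε hq
  have hspec := columnLoop_spec (minRow := minRow) (Γ := Γ) h.le h.close h.closed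
  obtain ⟨hyj, hnc, hmem, _, hcheck⟩ := (hspec.2.1 q).1 hq
  have hcl := hspec.1
  generalize columnLoop A ε minRow I Γ ((List.finRange m).drop y) J = r at *
  refine ⟨q.col.2, hsub.2, hlen, fun k hk => ?_, fun k hk hkc => ?_, fun g hg => ?_,
    fun t ht => ?_, ?_, fun g hg => ?_, fun g hg hgΓ => ?_⟩
  · by_cases hkj : k = q.col
    · rw [hkj]
      exact hpar.close
    · rw [Function.update_of_ne hkj, hcl] at hk
      exact hk.mono hsubF
  · by_cases hkj : k = q.col
    · rw [hkj, Function.update_self]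
    · rw [Function.update_of_ne hkj, hcl]
      exact hpar.close_before k (lt_of_le_of_ne (Fin.le_def.2 (by omega)) hkj) hkc
  · obtain ⟨k, hk, hk'⟩ := hpar.maximal g (by rwa [List.mem_toFinset])
    exact ⟨k, Nat.lt_succ_of_le hk, hk'⟩
  · obtain ⟨x, hx, hx'⟩ := Finset.exists_of_ssubset hpar.ssubset
    refine ⟨x, by rwa [List.mem_toFinset] at hx', fun k hk hkc => ?_⟩
    exact (hpar.close_before k (Fin.lt_def.2 (by omega)) hkc).mono
      (Finset.insert_subset hx hsubF)
  · rw [hcheck]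
    exact nodup_computeRM h.check_nodup h.nodup h.check_disjoint
  · rw [hcheck] at hg
    rcases mem_or_of_mem_computeRM hg with hg | hg
    · exact fun hgq => h.check_disjoint g hg (hsub.1 hgq)
    · exact hg.2
  · rw [hcheck] at hgΓ
    by_cases hgI : g ∈ I
    · exact ⟨q.col, Nat.lt_succ_self _, hpar.close, fun S hS hcard =>
        not_close_of_notMem_computeRM hmin hgI hg hgΓ hS hcard⟩
    · obtain ⟨k, hk, hkc, hkS⟩ := h.excluded g hgI fun hh => hgΓ (subset_computeRM _ _ _ _ _ hh)
      exact ⟨k, by omega, hkc.mono hsubF, fun S hS => hkS S (hS.trans hsubF)⟩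

theorem exists_mem_queue (hε : 0 ≤ ε) (hmin : 1 ≤ minRow) (h : IsCallState A ε minRow I J y Γ)
    {G : Finset (Fin n)} (hG : IsParent A ε G I.toFinset) (hcard : minRow ≤ G.card) :
    ∃ q ∈ (columnLoop A ε minRow I Γ ((List.finRange m).drop y) J).val.2,
      q.rows.toFinset = G := by
  obtain ⟨j, hG⟩ := hG
  -- Before column `y - 1` the row given by `least` can still be added to `I`, so `I` would not be a
  -- first extension for a smaller `j`.
  have hyj : y ≤ j := by
    by_contra hlt
    obtain ⟨g, hg, hgc⟩ := h.least (y - 1) (by omega)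
    obtain ⟨k, hk, hkc, hknc⟩ := hG.first g (by rwa [List.mem_toFinset])
    refine hknc ((hgc k (by rw [Fin.lt_def] at hk; omega) (hG.close_before k hk hkc)).mono ?_)
    exact Finset.union_subset ((Finset.filter_subset _ _).trans (Finset.subset_insert _ _))
      (Finset.insert_subset_insert g hG.ssubset.subset)
  have hspec := columnLoop_spec (minRow := minRow) (Γ := Γ) h.le h.close h.closed
  have hcl := hspec.1
  obtain ⟨L, hL, rfl⟩ := newRowSets_complete hε hG.ssubset.subset
    (Finset.card_pos.1 (by omega)) hG.close fun g hg hgG hc => by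
      obtain ⟨k, hk, hkc, hknc⟩ := hG.maximal g hgG
      rcases hk.lt_or_eq with hk | rfl
      · exact hknc ((hG.close_before k hk hkc).mono
          (Finset.insert_subset (List.mem_toFinset.2 hg) hG.ssubset.subset))
      · exact hknc hc
  refine ⟨⟨L, j, (computeRM A ε minRow L j Γ I).val⟩,
    (hspec.2.1 _).2 ⟨hyj, hG.not_close, hL, ⟨?_, ?_, ?_⟩, rfl⟩, rfl⟩
  · exact hcard.trans (List.toFinset_card_le L)
  · rw [val_canonical]
    intro k hk hkr hkc
    rw [← Bool.not_eq_true, hcl] at hkr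
    exact hkr (hG.close_before k hk hkc)
  · rw [val_rowCanonical]
    intro g hg
    have hgI := h.check_disjoint g hg
    constructor
    · rintro ⟨h1, h2⟩
      obtain ⟨k, hk, hkc, hknc⟩ := hG.maximal g fun hgL =>
        hgI (List.mem_toFinset.1 (hG.ssubset.subset hgL))
      rcases hk.lt_or_eq with hk | rfl
      · exact hknc (h1 k hk ((hcl k).2 (hG.close_before k hk hkc)))
      · exact hknc h2
    · intro h1
      obtain ⟨k, hk, hkc, hknc⟩ := hG.first g (by rwa [List.mem_toFinset])
      exact hknc (h1 k hk ((hcl k).2 (hG.close_before k hk hkc)))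

/-- Within one column the windows differ; across columns `col_unique` forbids a repeated row set. -/
theorem queue_pairwise (hε : 0 ≤ ε) (h : IsCallState A ε minRow I J y Γ) :
    (columnLoop A ε minRow I Γ ((List.finRange m).drop y) J).val.2.Pairwise fun q q' =>
      q.rows.toFinset ≠ q'.rows.toFinset := by
  refine ((columnLoop_spec h.le h.close h.closed).2.2 hε h.nodup).imp_of_mem ?_
  intro q q' hq hq' hne heq
  have h1 := (h.isParentAt_of_mem_queue hε hq).1
  have h2 := (h.isParentAt_of_mem_queue hε hq').1
  rw [← heq] at h2
  exact hne (h1.col_unique h2) heq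

end IsCallState

/-! ### The output -/

theorem val_drainQueue {α : Type} {rec : QueueItem n m → List α → Timed (List α)}
    {f : QueueItem n m → List α} {qs : List (QueueItem n m)}
    (h : ∀ q ∈ qs, ∀ out, (rec q out).val = f q ++ out) (out : List α) :
    (drainQueue rec qs out).val = qs.reverse.flatMap f ++ out := by
  induction qs generalizing out with
  | nil => rfl
  | cons q qs ih =>
    simp [drainQueue, h q (by simp), ih fun q hq => h q (by simp [hq])]

/-- The output list is only extended and never read, so the calls can be analysed separately with an
empty one. -/
theorem val_computeBiclustersFrom_append (minRow depth : ℕ) (I : List (Fin n)) (J : Fin m → Bool)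
    (y : ℕ) (Γ : List (Fin n)) (out : List (List (Fin n) × (Fin m → Bool))) :
    (computeBiclustersFrom A ε minRow depth I J y Γ out).val =
      (computeBiclustersFrom A ε minRow depth I J y Γ []).val ++ out := by
  induction depth generalizing I J y Γ out with
  | zero => rfl
  | succ depth ih =>
    have key := fun (r : Fin m → Bool) (out : List (List (Fin n) × (Fin m → Bool)))
        (qs : List (QueueItem n m)) =>
      val_drainQueue (qs := qs) (rec := fun q acc => do
        charge m
        let H ← step (Function.update r q.col true)
        computeBiclustersFrom A ε minRow depth q.rows H (q.col + 1) q.check acc)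
        (fun q _ out => ih q.rows (Function.update r q.col true) (q.col + 1) q.check out) out
    simp only [computeBiclustersFrom, Timed.val_bind, Timed.val_step, key]
    simp

theorem val_computeBiclustersFrom_succ (minRow depth : ℕ) (I : List (Fin n)) (J : Fin m → Bool)
    (y : ℕ) (Γ : List (Fin n)) :
    (computeBiclustersFrom A ε minRow (depth + 1) I J y Γ []).val =
      ((columnLoop A ε minRow I Γ ((List.finRange m).drop y) J).val.2.reverse.flatMap fun q =>
        (computeBiclustersFrom A ε minRow depth q.rows (Function.update
          (columnLoop A ε minRow I Γ ((List.finRange m).drop y) J).val.1 q.col true)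
          (q.col + 1) q.check []).val) ++
      [(I, (columnLoop A ε minRow I Γ ((List.finRange m).drop y) J).val.1)] := by
  simp only [computeBiclustersFrom, Timed.val_bind, Timed.val_step]
  exact val_drainQueue (fun q _ out => val_computeBiclustersFrom_append ..) _

theorem computeBiclustersFrom_spec (hε : 0 ≤ ε) {minRow : ℕ} (hmin : 1 ≤ minRow) {depth y : ℕ}
    -- Together with `y ≤ m`, the bound `hdepth` keeps `depth` positive; the depth cut-off is never
    -- reached.
    {I Γ : List (Fin n)} {J : Fin m → Bool} (h : IsCallState A ε minRow I J y Γ)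
    (hdepth : m + 1 ≤ depth + y) :
    (∀ B ∈ (computeBiclustersFrom A ε minRow depth I J y Γ []).val,
      B.1.Nodup ∧ minRow ≤ B.1.length ∧ RowMaximal A ε B.1.toFinset ∧
      (∀ k, B.2 k = true ↔ Close A ε B.1.toFinset k) ∧
      Relation.ReflTransGen (IsParent A ε) B.1.toFinset I.toFinset) ∧
    ((computeBiclustersFrom A ε minRow depth I J y Γ []).val.map fun B => B.1.toFinset).Nodup ∧
    (∀ S, minRow ≤ S.card → Relation.ReflTransGen (IsParent A ε) S I.toFinset →
      ∃ B ∈ (computeBiclustersFrom A ε minRow depth I J y Γ []).val, B.1.toFinset = S) := by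
  induction depth generalizing I J y Γ with
  | zero =>
    have := h.le
    omega
  | succ depth ih =>
    rw [val_computeBiclustersFrom_succ]
    have hq : ∀ q ∈ (columnLoop A ε minRow I Γ ((List.finRange m).drop y) J).val.2, _ :=
      fun q hq => ih (h.child hε hmin hq) (by
        have := (((columnLoop_spec h.le h.close h.closed).2.1 q).1 hq).1
        omega)
    have hpar : ∀ q ∈ (columnLoop A ε minRow I Γ ((List.finRange m).drop y) J).val.2,
        IsParent A ε q.rows.toFinset I.toFinset :=
      fun q hq => ⟨_, (h.isParentAt_of_mem_queue hε hq).1⟩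
    have hpw := h.queue_pairwise hε
    have hex := fun G => h.exists_mem_queue hε hmin (G := G)
    have hcl := h.closed_columns
    generalize columnLoop A ε minRow I Γ ((List.finRange m).drop y) J = r at *
    refine ⟨fun B hB => ?_, ?_, fun S hcard hS => ?_⟩
    · rw [List.mem_append, List.mem_flatMap, List.mem_singleton] at hB
      rcases hB with ⟨q, hqr, hB⟩ | rfl
      · rw [List.mem_reverse] at hqr
        obtain ⟨h1, h2, h3, h4, h5⟩ := (hq q hqr).1 B hB
        exact ⟨h1, h2, h3, h4, h5.tail (hpar q hqr)⟩
      · exact ⟨h.nodup, h.length, h.rowMaximal, hcl, Relation.ReflTransGen.refl⟩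
    · rw [List.map_append, List.map_flatMap, List.nodup_append', List.nodup_flatMap]
      refine ⟨⟨fun q hqr => (hq q (List.mem_reverse.1 hqr)).2.1, ?_⟩, by simp, ?_⟩
      · rw [List.pairwise_reverse]
        refine hpw.imp_of_mem fun {q q'} hq1 hq2 hne D hD hD' => hne ?_
        rw [List.mem_map] at hD hD'
        obtain ⟨B, hB, rfl⟩ := hD'
        obtain ⟨B', hB', hBB⟩ := hD
        have h2 := ((hq q' hq2).1 B' hB').2.2.2.2
        rw [hBB] at h2
        exact eq_of_common_descendant (hpar q hq1) (hpar q' hq2)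
          ((hq q hq1).1 B hB).2.2.2.2 h2
      · intro D hD hD'
        rw [List.mem_flatMap] at hD
        obtain ⟨q, hqr, hD⟩ := hD
        rw [List.mem_reverse] at hqr
        rw [List.mem_map] at hD
        obtain ⟨B, hB, rfl⟩ := hD
        simp only [List.map_cons, List.map_nil, List.mem_singleton] at hD'
        have h1 := subset_of_reflTransGen ((hq q hqr).1 B hB).2.2.2.2
        obtain ⟨j, hj⟩ := hpar q hqr
        rw [hD'] at h1
        exact hj.ssubset.not_subset h1
    · rcases hS.cases_tail with hS | ⟨G, hSG, hGI⟩
      · exact ⟨(I, r.val.1), by simp, hS⟩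
      -- The last set `G` on the chain from `S` to `I` contains `S`, so it is large enough to be
      -- queued.
      · obtain ⟨q, hqr, rfl⟩ := hex G hGI
          (hcard.trans (Finset.card_le_card (subset_of_reflTransGen hSG)))
        obtain ⟨B, hB, hBS⟩ := (hq q hqr).2.2 S hcard hSG
        refine ⟨B, List.mem_append_left _ (List.mem_flatMap.2 ⟨q, ?_, hB⟩), hBS⟩
        exact List.mem_reverse.2 hqr

theorem isMaximalCVC_iff {I : Finset (Fin n)} {J : Finset (Fin m)} :
    IsMaximalCVC A ε I J ↔ RowMaximal A ε I ∧ ∀ k, k ∈ J ↔ Close A ε I k := by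
  simp only [IsMaximalCVC, isCVC_iff]
  constructor
  · rintro ⟨h1, h2, h3⟩
    have hJ : ∀ k, k ∈ J ↔ Close A ε I k := by
      refine fun k => ⟨h1 k, fun hk => ?_⟩
      by_contra hkJ
      refine h3 k hkJ fun l hl => ?_
      rcases Finset.mem_insert.1 hl with rfl | hl
      · exact hk
      · exact h1 l hl
    refine ⟨fun g hg => ?_, hJ⟩
    have := h2 g hg
    push Not at this
    obtain ⟨k, hk, hk'⟩ := this
    exact ⟨k, h1 k hk, hk'⟩
  · rintro ⟨h1, h2⟩
    refine ⟨fun j hj => (h2 j).1 hj, fun x hx hcon => ?_, fun y hy hcon => ?_⟩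
    · obtain ⟨k, hk, hk'⟩ := h1 x hx
      exact hk' (hcon k ((h2 k).2 hk))
    · exact hy ((h2 y).2 (hcon y (by simp)))

theorem val_rinCloseCVC2 (minRow : ℕ) : (rinCloseCVC2 A ε minRow).val =
    (computeBiclustersFrom A ε minRow (m + 1) (List.finRange n) (fun _ => false) 0 [] []).val :=
  rfl

theorem mem_output_iff (hε : 0 ≤ ε) {minRow : ℕ} (hmin : 1 ≤ minRow) (hn : minRow ≤ n)
    (B : Finset (Fin n) × Finset (Fin m)) :
    B ∈ output A ε minRow ↔ B ∈ maximalBiclusters A ε minRow := by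
  obtain ⟨h1, _, h3⟩ := computeBiclustersFrom_spec hε hmin (isCallState_univ (A := A) (ε := ε) hn)
    (depth := m + 1) le_rfl
  rw [output, val_rinCloseCVC2, List.mem_map, maximalBiclusters, Set.mem_ofPred_eq,
    isMaximalCVC_iff]
  constructor
  · rintro ⟨B, hB, rfl⟩
    obtain ⟨hB1, hB2, hB3, hB4, _⟩ := h1 B hB
    exact ⟨⟨hB3, by simpa using hB4⟩, by rwa [List.toFinset_card_of_nodup hB1]⟩
  · rintro ⟨⟨hB1, hB2⟩, hB3⟩
    obtain ⟨B', hB', hBB⟩ := h3 B.1 hB3 (by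
      rw [List.toFinset_finRange]
      exact hB1.reflTransGen_univ)
    refine ⟨B', hB', Prod.ext hBB ?_⟩
    ext k
    rw [Finset.mem_filter, (h1 B' hB').2.2.2.1 k, hBB, hB2]
    simp

theorem nodup_output (hε : 0 ≤ ε) {minRow : ℕ} (hmin : 1 ≤ minRow) (hn : minRow ≤ n) :
    (output A ε minRow).Nodup := by
  obtain ⟨_, h2, _⟩ := computeBiclustersFrom_spec hε hmin (isCallState_univ (A := A) (ε := ε) hn)
    (depth := m + 1) le_rfl
  -- Distinct row sets are enough.
  refine List.Nodup.of_map Prod.fst ?_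
  rw [output, List.map_map]
  exact h2

theorem length_rinCloseCVC2 (hε : 0 ≤ ε) {minRow : ℕ} (hmin : 1 ≤ minRow) (hn : minRow ≤ n) :
    (rinCloseCVC2 A ε minRow).val.length = (maximalBiclusters A ε minRow).ncard := by
  have h : maximalBiclusters A ε minRow = ((output A ε minRow).toFinset : Set _) := by
    ext B
    rw [← mem_output_iff hε hmin hn]
    simp
  rw [h, Set.ncard_coe_finset, List.toFinset_card_of_nodup (nodup_output hε hmin hn), output,
    List.length_map]

/-! ### The running time -/

theorem time_colMax (k : Fin m) (x : ℝ) (L : List (Fin n)) :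
    (colMax A k x L).time = 2 * L.length + 1 := by
  induction L generalizing x with
  | nil => rfl
  | cons i L ih =>
    simp only [colMax, Timed.time_bind, time_entry, Timed.time_leq, ih, List.length_cons]
    ring

theorem time_colMin (k : Fin m) (x : ℝ) (L : List (Fin n)) :
    (colMin A k x L).time = 2 * L.length + 1 := by
  induction L generalizing x with
  | nil => rfl
  | cons i L ih =>
    simp only [colMin, Timed.time_bind, time_entry, Timed.time_leq, ih, List.length_cons]
    ring

theorem time_consistent_le (k : Fin m) (L : List (Fin n)) :
    (consistent A ε k L).time ≤ 4 * L.length + 1 := by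
  cases L with
  | nil => simp [consistent]
  | cons i L =>
    simp only [consistent, Timed.time_bind, time_entry, Timed.time_leq, time_colMax, time_colMin,
      Timed.time_step, List.length_cons]
    omega

theorem time_canonical_le (J : Fin m → Bool) (j : Fin m) (G : List (Fin n)) :
    (canonical A ε J j G).time ≤ m * (4 * G.length + 5) + 1 := by
  refine (time_checkAll_le (c := 4 * G.length + 4) fun k _ => ?_).trans (by simp)
  have := time_consistent_le (A := A) (ε := ε) k G
  simp only [Timed.time_bind, Timed.time_step, Timed.time_ite]
  split_ifs <;> omega

theorem time_correctBefore_le (J : Fin m → Bool) (j : Fin m) (L : List (Fin n)) :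
    (correctBefore A ε J j L).time ≤ m * (4 * L.length + 4) + 1 := by
  refine (time_checkAll_le (c := 4 * L.length + 3) fun k _ => ?_).trans (by simp)
  have := time_consistent_le (A := A) (ε := ε) k L
  simp only [Timed.time_bind, Timed.time_step, Timed.time_ite]
  split_ifs <;> omega

theorem time_rowCanonical_le (hn : 1 ≤ n) (hm : 1 ≤ m) {I Γ G : List (Fin n)}
    (hI : I.length ≤ n) (hΓ : Γ.length ≤ n) (hG : G.length ≤ n) (J : Fin m → Bool) (j : Fin m) :
    (rowCanonical A ε I J Γ j G).time ≤ 60 * (n ^ 2 * m) := by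
  have hnm : n ≤ n * m := Nat.le_mul_of_pos_right n hm
  have hmn : m ≤ n * m := Nat.le_mul_of_pos_left m hn
  have hn2 : n * m ≤ n ^ 2 * m := Nat.mul_le_mul_right m (by nlinarith)
  -- The longest list tested is `I` below `g`, then `g`, then `G`: at most `2 * n + 1` entries,
  -- hence at most `3 * n`.
  have hcb : ∀ L : List (Fin n), L.length ≤ 3 * n →
      (correctBefore A ε J j L).time ≤ 17 * (n * m) := by
    intro L hL
    refine (time_correctBefore_le J j L).trans ?_
    have : m * (4 * L.length + 4) ≤ m * (4 * (3 * n) + 4) := by gcongr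
    linarith
  have h1 : (checkAny (fun g => do
      let c ← correctBefore A ε J j (g :: G)
      if c then consistent A ε j (g :: G) else step false) Γ).time ≤
      n * (26 * (n * m) + 1) + 1 := by
    refine (time_checkAny_le (c := 26 * (n * m)) fun g _ => ?_).trans (by gcongr)
    have h := hcb (g :: G) (by simp only [List.length_cons]; omega)
    have h' := time_consistent_le (A := A) (ε := ε) j (g :: G)
    simp only [List.length_cons] at h'
    simp only [Timed.time_bind, Timed.time_step, Timed.time_ite]
    split_ifs <;> linarith
  have h2 : (checkAny (fun g => do
      let P ← filterT (fun i => step (decide (i < g))) I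
      let Q ← appendT P (g :: G)
      correctBefore A ε J j Q) Γ).time ≤ n * (22 * (n * m) + 1) + 1 := by
    refine (time_checkAny_le (c := 22 * (n * m)) fun g _ => ?_).trans (by gcongr)
    have hf := time_filterT_le (p := fun i => step (decide (i < g))) (l := I) (c := 1)
      fun i _ => le_rfl
    have hl : (I.filter fun i => (step (decide (i < g))).val).length ≤ n :=
      (List.length_filter_le _ _).trans hI
    have h := hcb ((I.filter fun i => (step (decide (i < g))).val) ++ g :: G) (by
      simp only [List.length_append, List.length_cons]; omega)
    simp only [Timed.time_bind, val_filterT, val_appendT, time_appendT]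
    linarith
  simp only [rowCanonical, Timed.time_bind, Timed.time_ite, Timed.time_step]
  have : n * (n * m) = n ^ 2 * m := by ring
  split_ifs <;> linarith

theorem time_insertByCol_le (j : Fin m) (i : Fin n) (L : List (Fin n)) :
    (insertByCol A j i L).time ≤ 4 * L.length + 1 := by
  induction L with
  | nil => simp [insertByCol]
  | cons h t ih =>
    simp only [insertByCol, Timed.time_bind, time_entry, Timed.time_leq, Timed.time_ite,
      Timed.time_step, List.length_cons]
    split_ifs <;> omega

theorem time_sortByCol_le (j : Fin m) (L : List (Fin n)) :
    (sortByCol A j L).time ≤ 4 * L.length ^ 2 + L.length + 1 := by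
  induction L with
  | nil => simp [sortByCol]
  | cons i t ih =>
    have h := time_insertByCol_le (A := A) j i (sortByCol A j t).val
    rw [(sortByCol_perm j t).length_eq] at h
    simp only [sortByCol, Timed.time_bind, List.length_cons]
    nlinarith

theorem time_windowFrom_le (j : Fin m) (a : ℝ) (L : List (Fin n)) :
    (windowFrom A ε j a L).time ≤ 4 * L.length + 1 := by
  induction L with
  | nil => simp [windowFrom]
  | cons i t ih =>
    simp only [windowFrom, Timed.time_bind, time_entry, Timed.time_leq, Timed.time_ite,
      Timed.time_step, List.length_cons]
    split_ifs <;> omega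

theorem time_windows_le (j : Fin m) (p : ℕ) (L : List (Fin n)) :
    (windows A ε j p L).time ≤ 5 * L.length ^ 2 + 5 * L.length + 1 := by
  induction L generalizing p with
  | nil => simp [windows]
  | cons i t ih =>
    have h1 := time_windowFrom_le (A := A) (ε := ε) j (A i j) (i :: t)
    have h2 : (windowFrom A ε j (A i j) (i :: t)).val.length ≤ (i :: t).length := by
      rw [val_windowFrom]
      exact (List.takeWhile_sublist _).length_le
    have h3 := ih (windowFrom A ε j (A i j) (i :: t)).val.length
    simp only [windows, Timed.time_bind, val_entry, time_entry, Timed.time_ite, Timed.time_step,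
      time_lengthT, val_lengthT, ite_self]
    simp only [List.length_cons] at h1 h2 ⊢
    nlinarith

theorem time_newRowSets_le {I : List (Fin n)} (hn : 1 ≤ n) (hI : I.length ≤ n) (j : Fin m) :
    (newRowSets A ε I j).time ≤ 17 * n ^ 2 := by
  have h1 := time_sortByCol_le (A := A) j I
  have h2 := time_windows_le (A := A) (ε := ε) j 0 (sortByCol A j I).val
  rw [(sortByCol_perm j I).length_eq] at h2
  have h3 : I.length ^ 2 ≤ n ^ 2 := Nat.pow_le_pow_left hI 2
  have h4 : n ≤ n ^ 2 := Nat.le_self_pow two_ne_zero n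
  simp only [newRowSets, Timed.time_bind]
  omega

theorem time_nthValue_le (j : Fin m) (L : List (Fin n)) (k : ℕ) :
    (nthValue A j L k).time ≤ L.length + 1 := by
  induction L generalizing k with
  | nil => simp [nthValue]
  | cons i t ih =>
    cases k with
    | zero => simp [nthValue]
    | succ k =>
      have := ih k
      simp only [nthValue, Timed.time_bind, Timed.time_charge, List.length_cons]
      omega

theorem time_computeRM_le (hn : 1 ≤ n) {I Γ G : List (Fin n)}
    (hI : I.length ≤ n) (hΓ : Γ.length ≤ n) (hG : G.length ≤ n) (minRow : ℕ) (j : Fin m) :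
    (computeRM A ε minRow G j Γ I).time ≤ 30 * n ^ 2 := by
  have h1 := time_sortByCol_le (A := A) j G
  have hl := (sortByCol_perm (A := A) j G).length_eq
  have h2 := time_nthValue_le (A := A) j (sortByCol A j G).val (minRow - 1)
  have h3 := time_nthValue_le (A := A) j (sortByCol A j G).val
    ((sortByCol A j G).val.length - minRow)
  have h4 : ∀ p1 p2 : ℝ, (filterT (fun i => do
      let inG ← checkAny (fun g => step (decide (i = g))) G
      if inG then step false
      else do
        let x ← entry A i j
        let d1 ← step (p1 - x)
        let b1 ← leq d1 ε
        if b1 then step true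
        else do
          let d2 ← step (x - p2)
          leq d2 ε) I).time ≤ n * (2 * n + 7) + 1 := by
    intro p1 p2
    refine (time_filterT_le (c := 2 * n + 6) fun i _ => ?_).trans (by gcongr)
    have := time_checkAny_le (p := fun g => step (decide (i = g))) (l := G) (c := 1)
      fun g _ => le_rfl
    simp only [Timed.time_bind, Timed.time_ite, Timed.time_step, time_entry, Timed.time_leq]
    split_ifs <;> omega
  have h5 := h4 (nthValue A j (sortByCol A j G).val (minRow - 1)).val
    (nthValue A j (sortByCol A j G).val ((sortByCol A j G).val.length - minRow)).val
  have h6 : G.length ^ 2 ≤ n ^ 2 := Nat.pow_le_pow_left hG 2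
  have h7 : n ≤ n ^ 2 := Nat.le_self_pow two_ne_zero n
  rw [hl] at h2
  rw [hl] at h3 h5
  simp only [computeRM, Timed.time_bind, time_lengthT, val_lengthT, time_appendT, hl]
  linarith

theorem time_candidateLoop_le (hn : 1 ≤ n) (hm : 1 ≤ m) {I Γ : List (Fin n)}
    (hI : I.length ≤ n) (hΓ : Γ.length ≤ n) (minRow : ℕ) (J : Fin m → Bool) (j : Fin m)
    {Gs : List (List (Fin n))} (hGs : ∀ G ∈ Gs, G.length ≤ n) :
    (candidateLoop A ε minRow I J Γ j Gs).time ≤ Gs.length * (110 * (n ^ 2 * m)) + 1 := by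
  induction Gs with
  | nil => simp [candidateLoop]
  | cons G Gs ih =>
    have ih := ih fun G hG => hGs G (by simp [hG])
    have hG := hGs G (by simp)
    have h1 := time_canonical_le (A := A) (ε := ε) J j G
    have h1' : m * (4 * G.length + 5) ≤ m * (4 * n + 5) := by gcongr
    have h2 := time_rowCanonical_le (A := A) (ε := ε) hn hm hI hΓ hG J j
    have h3 := time_computeRM_le (A := A) (ε := ε) hn hI hΓ hG minRow j
    have hn2 : n ≤ n ^ 2 := Nat.le_self_pow two_ne_zero n
    have hnm : n ≤ n * m := Nat.le_mul_of_pos_right n hm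
    have hmn : m ≤ n * m := Nat.le_mul_of_pos_left m hn
    have hn2m : n ^ 2 ≤ n ^ 2 * m := Nat.le_mul_of_pos_right _ hm
    have hnn : n * m ≤ n ^ 2 * m := Nat.mul_le_mul_right m hn2
    simp only [candidateLoop, Timed.time_bind, Timed.time_ite, Timed.time_step, time_lengthT,
      List.length_cons]
    split_ifs <;> linarith

/-- The candidates dominate: at most `n` per column, each costing at most `110 * (n ^ 2 * m)`. The
surplus over `110` absorbs the consistency test, sorting, scanning and appending. -/
theorem time_columnLoop_le (hε : 0 ≤ ε) (hn : 1 ≤ n) (hm : 1 ≤ m) {I Γ : List (Fin n)}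
    (hI : I.length ≤ n) (hΓ : Γ.length ≤ n) (minRow : ℕ) (js : List (Fin m)) (J : Fin m → Bool) :
    (columnLoop A ε minRow I Γ js J).time ≤ js.length * (140 * (n ^ 3 * m)) + 1 := by
  induction js generalizing J with
  | nil => simp [columnLoop]
  | cons j js ih =>
    have h1 := time_consistent_le (A := A) (ε := ε) j I
    have h2 := time_newRowSets_le (A := A) (ε := ε) hn hI j
    have hlen : (newRowSets A ε I j).val.length ≤ n := (length_newRowSets_le hε I j).trans hI
    have h3 := time_candidateLoop_le (A := A) (ε := ε) hn hm hI hΓ minRow J j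
      (Gs := (newRowSets A ε I j).val)
      fun G hG => (subperm_of_mem_newRowSets hε hG).length_le.trans hI
    have h3' : (newRowSets A ε I j).val.length * (110 * (n ^ 2 * m)) ≤ n * (110 * (n ^ 2 * m)) := by
      gcongr
    have h4 : (candidateLoop A ε minRow I J Γ j (newRowSets A ε I j).val).val.length ≤ n := by
      rw [val_candidateLoop, List.length_map]
      exact (List.length_filter_le _ _).trans hlen
    have hn2 : n ≤ n ^ 2 := Nat.le_self_pow two_ne_zero n
    have hn3 : n ^ 2 ≤ n ^ 3 := Nat.pow_le_pow_right hn (by norm_num)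
    have hn3m : n ^ 3 ≤ n ^ 3 * m := Nat.le_mul_of_pos_right _ hm
    have hmul : n * (110 * (n ^ 2 * m)) = 110 * (n ^ 3 * m) := by ring
    have ih1 := ih J
    have ih2 := ih (step (Function.update J j true)).val
    simp only [columnLoop, Timed.time_bind, Timed.time_step, Timed.time_ite,
      time_appendT, List.length_cons]
    split_ifs <;> linarith

theorem time_drainQueue_le {α : Type} {rec : QueueItem n m → List α → Timed (List α)}
    {f : QueueItem n m → List α} {qs : List (QueueItem n m)} {K : ℕ}
    (h : ∀ q ∈ qs, ∀ out, (rec q out).time ≤ K * (f q).length) (out : List α) :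
    (drainQueue rec qs out).time ≤ K * (qs.reverse.flatMap f).length + 1 := by
  induction qs generalizing out with
  | nil => simp [drainQueue]
  | cons q qs ih =>
    have h1 := h q (by simp) out
    have h2 := ih (fun q hq => h q (by simp [hq])) (rec q out).val
    simp only [drainQueue, Timed.time_bind, List.reverse_cons, List.flatMap_append,
      List.length_append, List.flatMap_cons, List.flatMap_nil, List.append_nil, mul_add]
    omega

/-- The cost of a call, including the copy of the column array made for it, is proportional to the
number of biclusters that it writes. -/
theorem time_computeBiclustersFrom_le (hε : 0 ≤ ε) (hn : 1 ≤ n) (hm : 1 ≤ m) {minRow : ℕ}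
    (hmin : 1 ≤ minRow) {depth y : ℕ} {I Γ : List (Fin n)} {J : Fin m → Bool}
    (h : IsCallState A ε minRow I J y Γ) (hdepth : m + 1 ≤ depth + y)
    (out : List (List (Fin n) × (Fin m → Bool))) :
    -- The summand `m + 1` is what the caller pays to copy and update the column array. Including it
    -- makes the bounds for the children add up without a count of the queue.
    (computeBiclustersFrom A ε minRow depth I J y Γ out).time + (m + 1) ≤
      150 * (n ^ 3 * m ^ 2) * (computeBiclustersFrom A ε minRow depth I J y Γ []).val.length := by
  induction depth generalizing I J y Γ out with
  | zero =>
    have := h.le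
    omega
  | succ depth ih =>
    have hI : I.length ≤ n := by simpa using h.nodup.length_le_card
    have hΓ : Γ.length ≤ n := by simpa using h.check_nodup.length_le_card
    have hcol := time_columnLoop_le (A := A) hε hn hm hI hΓ minRow ((List.finRange m).drop y) J
    have hcol' : ((List.finRange m).drop y).length * (140 * (n ^ 3 * m)) ≤
        m * (140 * (n ^ 3 * m)) := by
      gcongr
      simp
    have hdrain := time_drainQueue_le (K := 150 * (n ^ 3 * m ^ 2))
      (qs := (columnLoop A ε minRow I Γ ((List.finRange m).drop y) J).val.2)
      (rec := fun q acc => do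
        charge m
        let H ← step (Function.update
          (columnLoop A ε minRow I Γ ((List.finRange m).drop y) J).val.1 q.col true)
        computeBiclustersFrom A ε minRow depth q.rows H (q.col + 1) q.check acc)
      (f := fun q => (computeBiclustersFrom A ε minRow depth q.rows (Function.update
          (columnLoop A ε minRow I Γ ((List.finRange m).drop y) J).val.1 q.col true)
          (q.col + 1) q.check []).val)
      (fun q hq out => by
        have hy := (((columnLoop_spec h.le h.close h.closed).2.1 q).1 hq).1
        refine le_trans (le_of_eq ?_) (ih (h.child hε hmin hq) (by omega) out)
        simp only [Timed.time_bind, Timed.time_charge, Timed.time_step, Timed.val_step]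
        ring)
      ((I, (columnLoop A ε minRow I Γ ((List.finRange m).drop y) J).val.1) :: out)
    rw [val_computeBiclustersFrom_succ, List.length_append, List.length_singleton, mul_add]
    simp only [computeBiclustersFrom, Timed.time_bind, Timed.time_charge, Timed.time_step,
      Timed.val_step]
    have hn3 : n ≤ n ^ 3 := Nat.le_self_pow (by norm_num) n
    have hm2 : m ≤ m ^ 2 := Nat.le_self_pow two_ne_zero m
    have h1 : n ^ 3 ≤ n ^ 3 * m ^ 2 := Nat.le_mul_of_pos_right _ (by positivity)
    have h2 : m ^ 2 ≤ n ^ 3 * m ^ 2 := Nat.le_mul_of_pos_left _ (by positivity)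
    have hmul : m * (140 * (n ^ 3 * m)) = 140 * (n ^ 3 * m ^ 2) := by ring
    linarith

theorem runningTime_le (hε : 0 ≤ ε) (hm : 1 ≤ m) {minRow : ℕ} (hmin : 1 ≤ minRow)
    (hn : minRow ≤ n) :
    runningTime A ε minRow ≤
      152 * ((maximalBiclusters A ε minRow).ncard * n ^ 3 * m ^ 2) := by
  have h := time_computeBiclustersFrom_le hε (hmin.trans hn) hm hmin
    (isCallState_univ (A := A) (ε := ε) hn) (depth := m + 1) le_rfl []
  rw [← val_rinCloseCVC2, length_rinCloseCVC2 hε hmin hn] at h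
  -- With no bicluster the bound would force the positive cost of the root call to vanish; `1 ≤ q`
  -- is needed to absorb the `n + m` steps of the initial setup.
  have hq : 1 ≤ (maximalBiclusters A ε minRow).ncard := by
    by_contra! hcon
    rw [Nat.lt_one_iff.1 hcon, mul_zero] at h
    omega
  have hn1 : 1 ≤ n := hmin.trans hn
  have hn3 : n ≤ n ^ 3 := Nat.le_self_pow (by norm_num) n
  have h1 : n ^ 3 ≤ n ^ 3 * m ^ 2 := Nat.le_mul_of_pos_right _ (by positivity)
  have h2 : n ^ 3 * m ^ 2 ≤ (maximalBiclusters A ε minRow).ncard * (n ^ 3 * m ^ 2) :=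
    Nat.le_mul_of_pos_left _ hq
  simp only [runningTime, rinCloseCVC2, Timed.time_bind, Timed.time_charge]
  linarith

end RInClose

theorem mainTheorem3 :
    ∃ C : ℕ, ∀ (n m minRow : ℕ) (A : Matrix (Fin n) (Fin m) ℝ) (ε : ℝ),
      0 ≤ ε → 1 ≤ minRow → minRow ≤ n →
        -- efficient
        (1 ≤ m → RInClose.runningTime A ε minRow ≤
          C * ((RInClose.maximalBiclusters A ε minRow).ncard * n ^ 3 * m ^ 2)) ∧
        -- complete
        (∀ (I : Finset (Fin n)) (J : Finset (Fin m)),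
          RInClose.IsMaximalCVC A ε I J → minRow ≤ I.card →
            (I, J) ∈ RInClose.output A ε minRow) ∧
        -- correct
        (∀ B ∈ RInClose.output A ε minRow,
          RInClose.IsCVC A ε B.1 B.2 ∧ minRow ≤ B.1.card) ∧
        -- non-redundant
        (∀ B ∈ RInClose.output A ε minRow, RInClose.IsMaximalCVC A ε B.1 B.2) ∧
        (RInClose.output A ε minRow).Nodup := by
  refine ⟨152, fun n m minRow A ε hε hmin hn => ?_⟩
  have hmem := RInClose.mem_output_iff (A := A) hε hmin hn
  refine ⟨fun hm => RInClose.runningTime_le hε hm hmin hn,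
    fun I J hIJ hcard => (hmem (I, J)).2 ⟨hIJ, hcard⟩,
    fun B hB => ⟨((hmem B).1 hB).1.1, ((hmem B).1 hB).2⟩,
    fun B hB => ((hmem B).1 hB).1, RInClose.nodup_output hε hmin hn⟩
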